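/- Let $(\widehat M,\widehat g)$ be a finite-dimensional smooth semi-Riemannian manifold (without boundary) and $F:\widehat M\to\mathbb R$ a smooth function. Let $\overline M=\mathbb R\times\widehat M$ with the semi-Riemannian metric $\overline g=-dx^0\otimes dx^0+\pi^*\widehat g$, where $\pi:\overline M\to\widehat M$ is the projection and $x^0$ the coordinate on $\mathbb R$, and let $M=\{(t,p)\in\overline M: t=F(p)\}$ be the associated Monge-type hypersurface, with inclusion $i:M\hookrightarrow\overline M$ and induced metric $g=i^*\overline g$. Put $\partial_0=\partial/\partial x^0$, $\widehat\xi=\operatorname{grad}_{\widehat g}F$, let $\widehat\xi_L$ be the lift of $\widehat\xi$ to $\overline M$ (tangent to the factor $\widehat M$ and projecting to $\widehat\xi$), and set $$\xi=\partial_0+\widehat\xi_L,\qquad N_\xi=-\tfrac12\left(\partial_0-\widehat\xi_L\right).$$ Write $T_pM^\perp\subseteq T_p\overline M$ for the $\overline g$-orthogonal space of $T_pM$. Assume that $M$ is degenerate (lightlike): the radical spaces $\{u\in T_pM: g(u,v)=0\ \forall v\in T_pM\}$, $p\in M$, have a constant dimension $r>0$ and form a smooth distribution. Then: 1. $S(TM):=(\operatorname{span}\{\xi,\partial_0\})^{\perp}$,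 the $\overline g$-orthogonal complement taken in $T\overline M|_M$, is a screen distribution of $M$, that is, a smooth vector bundle with $TM=S(TM)\oplus TM^\perp$ (the canonical screen). 2. $S(TM)$ is integrable: the Lie bracket of two local sections of $S(TM)$ is again a section of $S(TM)$, and through every point of $M$ there passes an integral manifold of $S(TM)$. 3. The lightlike transversal bundle associated with $S(TM)$ is the line bundle spanned by $N_\xi|_M$. Here a lightlike transversal bundle associated with $S(TM)$ is a smooth line bundle $\operatorname{tr}(TM)\subset T\overline M|_M$ with $T\overline M|_M=TM\oplus \operatorname{tr}(TM)$ such that, for every smooth non-vanishing local section $\eta$ of $TM^\perp$ on an open set $U\subseteq M$ and every $p\in U$, there is an open neighbourhood $U'\subseteq U$ of $p$ on which there is exactly one smooth non-vanishing section $N$ of $\operatorname{tr}(TM)$ with $\overline g(\eta,N)=1$, $\overline g(N,N)=0$ and $\overline g(W,N)=0$ for all $W\in S(TM)$; the line bundle spanned by $N_\xi|_M$ has this property and is the only one that has it. 4. $N_\xi|_M$ is smooth, non-vanishing, null and orthogonal to $S(TM)$, and $\overline g(\xi,N_\xi)=1$ (on all of $\overline M$). -/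

import Mathlib

open scoped Manifold ContDiff Topology Bundle

noncomputable section

namespace LightlikeGeometry

section General

variable {E : Type*} [NormedAddCommGroup E] [NormedSpace ℝ E]
  {H : Type*} [TopologicalSpace H] (I : ModelWithCorners ℝ E H)
  (M : Type*) [TopologicalSpace M] [ChartedSpace H M]
  {E' : Type*} [NormedAddCommGroup E'] [NormedSpace ℝ E']
  {H' : Type*} [TopologicalSpace H'] (J : ModelWithCorners ℝ E' H')
  {N : Type*} [TopologicalSpace N] [ChartedSpace H' N]

/-- A (not necessarily smooth) field of bilinear forms on the tangent spaces of `M`. -/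
abbrev BilinField : Type _ :=
  ∀ x : M, TangentSpace I x →L[ℝ] TangentSpace I x →L[ℝ] ℝ

variable {M}

/-- The pullback `f^* g` of a field of bilinear forms `g` on `N` by a map `f : M → N`. -/
def pullback (g : BilinField J N) (f : M → N) : BilinField I M := fun x =>
  (ContinuousLinearMap.precomp ℝ (mfderiv I J f x)).comp ((g (f x)).comp (mfderiv I J f x))

@[simp] lemma pullback_apply (g : BilinField J N) (f : M → N) (x : M) (u v : TangentSpace I x) :
    pullback I J g f x u v = g (f x) (mfderiv I J f x u) (mfderiv I J f x v) := rfl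

/-- Smoothness of a field of bilinear forms, as a section of the bundle `Hom(TM, Hom(TM, ℝ))`. -/
def IsSmoothBilinField [IsManifold I ∞ M] (g : BilinField I M) : Prop :=
  ContMDiff I (I.prod 𝓘(ℝ, E →L[ℝ] E →L[ℝ] ℝ)) ∞
    (fun x => Bundle.TotalSpace.mk' (E →L[ℝ] E →L[ℝ] ℝ)
      (E := fun x : M => TangentSpace I x →L[ℝ] TangentSpace I x →L[ℝ] ℝ) x (g x))

lemma IsSmoothBilinField.pullback [IsManifold I ∞ M] [IsManifold J ∞ N] {g : BilinField J N}
    (hg : IsSmoothBilinField J g) {f : M → N} (hf : ContMDiff I J ∞ f) :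
    IsSmoothBilinField I (pullback I J g f) := by
  intro x₀
  have hG := ((contMDiffAt_hom_bundle _).1 (hg (f x₀))).2
  have hB := (hf.contMDiffAt (x := x₀)).mfderiv_const (m := ∞) (by simp)
  refine (contMDiffAt_hom_bundle _).2 ⟨contMDiffAt_id, ?_⟩
  have hGf := hG.comp x₀ (hf.contMDiffAt (x := x₀))
  have hP := hB.clm_precomp (F₃ := ℝ)
  refine (hP.clm_comp (hGf.clm_comp hB)).congr_of_eventuallyEq ?_
  have h1 : ∀ᶠ x in 𝓝 x₀, x ∈ (trivializationAt E (TangentSpace I) x₀).baseSet :=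
    (trivializationAt E (TangentSpace I) x₀).open_baseSet.mem_nhds
      (FiberBundle.mem_baseSet_trivializationAt' x₀)
  have h2 : ∀ᶠ x in 𝓝 x₀, f x ∈ (trivializationAt E' (TangentSpace J) (f x₀)).baseSet :=
    hf.continuous.continuousAt ((trivializationAt E' (TangentSpace J) (f x₀)).open_baseSet.mem_nhds
      (FiberBundle.mem_baseSet_trivializationAt' (f x₀)))
  filter_upwards [h1, h2] with x hx hfx
  ext v w
  have e1 := inCoordinates_apply_eq₂ (𝕜 := ℝ) (F₁ := E) (F₂ := E) (F₃ := ℝ)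
    (E₁ := (TangentSpace I : M → Type _)) (E₂ := (TangentSpace I : M → Type _))
    (E₃ := Bundle.Trivial M ℝ) (ϕ := LightlikeGeometry.pullback I J g f x) (v := v) (w := w)
    hx hx (Set.mem_univ _)
  have e2 := inCoordinates_apply_eq₂ (𝕜 := ℝ) (F₁ := E') (F₂ := E') (F₃ := ℝ)
    (E₁ := (TangentSpace J : N → Type _)) (E₂ := (TangentSpace J : N → Type _))
    (E₃ := Bundle.Trivial N ℝ) (ϕ := g (f x))
    (v := inTangentCoordinates I J id f (mfderiv I J f) x₀ x v)
    (w := inTangentCoordinates I J id f (mfderiv I J f) x₀ x w)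
    hfx hfx (Set.mem_univ _)
  have e3 : ∀ u : E, (trivializationAt E' (TangentSpace J) (f x₀)).symm (f x)
      (inTangentCoordinates I J id f (mfderiv I J f) x₀ x u) =
      mfderiv I J f x ((trivializationAt E (TangentSpace I) x₀).symm x u) := by
    intro u
    simp only [inTangentCoordinates, ContinuousLinearMap.inCoordinates, id]
    have h := (trivializationAt E' (TangentSpace J) (f x₀)).symm_linearMapAt (R := ℝ) hfx
      (mfderiv I J f x ((trivializationAt E (TangentSpace I) x₀).symmL ℝ x u))
    refine Eq.trans ?_ (h.trans (congrArg _ (Bundle.Trivialization.symmL_apply (R := ℝ) _ hx u)))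
    rfl
  rw [e3, e3] at e2
  refine e1.trans (Eq.trans ?_ e2.symm)
  simp


variable {I} in
lemma IsSmoothBilinField.add [IsManifold I ∞ M] {g g' : BilinField I M}
    (hg : IsSmoothBilinField I g) (hg' : IsSmoothBilinField I g') :
    IsSmoothBilinField I (fun x => g x + g' x) :=
  ContMDiff.add_section hg hg'

variable {I} in
lemma IsSmoothBilinField.neg [IsManifold I ∞ M] {g : BilinField I M}
    (hg : IsSmoothBilinField I g) : IsSmoothBilinField I (fun x => - g x) :=
  ContMDiff.neg_section hg

variable (M) in
/-- A semi-Riemannian metric on `M`: a smooth field of symmetric non-degenerate bilinear forms on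
the tangent spaces, with constant signature: `p` minus signs and `q` plus signs at every point. -/
structure SemiRiemannianMetric [IsManifold I ∞ M] where
  /-- the underlying field of bilinear forms -/
  form : BilinField I M
  symm : ∀ x u v, form x u v = form x v u
  nondegenerate : ∀ x u, (∀ v, form x u v = 0) → u = 0
  signature : ∃ p q : ℕ, ∀ x, ∃ b : Module.Basis (Fin p ⊕ Fin q) ℝ (TangentSpace I x),
    ∀ i j, form x (b i) (b j) = if i = j then Sum.elim (fun _ => -1) (fun _ => 1) i else 0
  smooth : IsSmoothBilinField I form

variable {I} in
/-- A non-degenerate bilinear form on a finite-dimensional space represents each functional. -/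
lemma SemiRiemannianMetric.existsUnique_repr [IsManifold I ∞ M] [FiniteDimensional ℝ E]
    (g : SemiRiemannianMetric I M) (x : M) (φ : TangentSpace I x →L[ℝ] ℝ) :
    ∃! u : TangentSpace I x, ∀ v, g.form x u v = φ v := by
  have : FiniteDimensional ℝ (TangentSpace I x) := inferInstanceAs (FiniteDimensional ℝ E)
  let L : TangentSpace I x →ₗ[ℝ] Module.Dual ℝ (TangentSpace I x) :=
    (ContinuousLinearMap.coeLM ℝ).comp (g.form x).toLinearMap
  have hL : Function.Injective L := by
    rw [injective_iff_map_eq_zero]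
    exact fun u hu => g.nondegenerate x u fun v => LinearMap.congr_fun hu v
  have hs : Function.Surjective L :=
    (LinearMap.injective_iff_surjective_of_finrank_eq_finrank
      (Subspace.dual_finrank_eq (K := ℝ) (V := TangentSpace I x)).symm).1 hL
  obtain ⟨u, hu⟩ := hs φ.toLinearMap
  refine ⟨u, fun v => LinearMap.congr_fun hu v, fun u' hu' => hL ?_⟩
  rw [hu]
  exact LinearMap.ext hu'

variable {I} in
/-- The gradient of `F` with respect to `g`: the vector field with `g(grad F, v) = dF(v)`. -/
def SemiRiemannianMetric.grad [IsManifold I ∞ M] [FiniteDimensional ℝ E]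
    (g : SemiRiemannianMetric I M) (F : M → ℝ) (x : M) : TangentSpace I x :=
  (g.existsUnique_repr x (mfderiv I 𝓘(ℝ, ℝ) F x)).choose

variable {I} in
lemma SemiRiemannianMetric.grad_spec [IsManifold I ∞ M] [FiniteDimensional ℝ E]
    (g : SemiRiemannianMetric I M) (F : M → ℝ) (x : M) (v : TangentSpace I x) :
    g.form x (g.grad F x) v = mfderiv I 𝓘(ℝ, ℝ) F x v :=
  (g.existsUnique_repr x (mfderiv I 𝓘(ℝ, ℝ) F x)).choose_spec.1 v

/-! ### Distributions and subbundles -/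

/-- `X`, a field of tangent vectors of `N` along `f : M → N`, is smooth on `U`. -/
def IsSmoothFieldOn [IsManifold J ∞ N] (f : M → N) (X : ∀ p : M, TangentSpace J (f p)) (U : Set M) : Prop :=
  ContMDiffOn I J.tangent ∞ (fun p => (⟨f p, X p⟩ : TangentBundle J N)) U

/-- `S` is a smooth vector subbundle of the restriction `f^* TN` of `TN` along `f`: near each point
it has a smooth local frame. With `f = id` this is the notion of a smooth distribution on `M`. -/
def IsSmoothSubbundle [IsManifold J ∞ N] (f : M → N) (S : ∀ p : M, Submodule ℝ (TangentSpace J (f p))) : Prop :=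
  ∀ p : M, ∃ U : Set M, IsOpen U ∧ p ∈ U ∧
    ∃ (k : ℕ) (X : Fin k → ∀ q : M, TangentSpace J (f q)),
      (∀ i, IsSmoothFieldOn I J f (X i) U) ∧
      ∀ q ∈ U, LinearIndependent ℝ (fun i => X i q) ∧
        Submodule.span ℝ (Set.range fun i => X i q) = S q

/-- A distribution is involutive if the Lie bracket of any two of its smooth local sections is
again a section of it. -/
def IsInvolutive [IsManifold I ∞ M] (D : ∀ p : M, Submodule ℝ (TangentSpace I p)) : Prop :=
  ∀ (U : Set M) (X Y : ∀ p : M, TangentSpace I p), IsOpen U →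
    IsSmoothFieldOn I I (fun p => p) X U → IsSmoothFieldOn I I (fun p => p) Y U →
    (∀ p ∈ U, X p ∈ D p) → (∀ p ∈ U, Y p ∈ D p) →
    ∀ p ∈ U, VectorField.mlieBracket I X Y p ∈ D p

/-- A distribution is integrable if through each point `p` there passes an integral manifold,
i.e. an injectively immersed disc `φ` with `φ(0) = p` whose tangent spaces are the fibres of `D`. -/
def IsIntegrable (D : ∀ p : M, Submodule ℝ (TangentSpace I p)) : Prop :=
  ∀ p : M, ∃ (k : ℕ) (r : ℝ) (φ : EuclideanSpace ℝ (Fin k) → M), 0 < r ∧ φ 0 = p ∧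
    ContMDiffOn 𝓘(ℝ, EuclideanSpace ℝ (Fin k)) I ∞ φ (Metric.ball 0 r) ∧
    Set.InjOn φ (Metric.ball 0 r) ∧
    ∀ u ∈ Metric.ball (0 : EuclideanSpace ℝ (Fin k)) r,
      Function.Injective (mfderiv 𝓘(ℝ, EuclideanSpace ℝ (Fin k)) I φ u) ∧
      LinearMap.range (mfderiv 𝓘(ℝ, EuclideanSpace ℝ (Fin k)) I φ u).toLinearMap = D (φ u)

/-! ### Lightlike manifolds and submanifolds -/

/-- The subspace orthogonal to `W` with respect to `g x`. -/
def orth (g : BilinField I M) (x : M) (W : Submodule ℝ (TangentSpace I x)) :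
    Submodule ℝ (TangentSpace I x) where
  carrier := {u | ∀ v ∈ W, g x u v = 0}
  zero_mem' := by simp
  add_mem' := by
    intro a b ha hb v hv
    simp [ha v hv, hb v hv]
  smul_mem' := by
    intro c a ha v hv
    simp [ha v hv]

/-- The radical space `Rad T_x M`. -/
def radical (g : BilinField I M) (x : M) : Submodule ℝ (TangentSpace I x) := orth I g x ⊤

/-- `(M, g)` is a lightlike (degenerate) manifold: the radical spaces have constant positive
dimension and form a smooth distribution. -/
def IsLightlikeManifold [IsManifold I ∞ M] (g : BilinField I M) : Prop :=
  (∃ r : ℕ, 0 < r ∧ ∀ x, Module.finrank ℝ (radical I g x) = r) ∧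
    IsSmoothSubbundle I I (fun x => x) (radical I g)

/-- The submanifold `i : M → N` of `(N, g)` is lightlike: `M` with the induced metric `i^* g` is a
lightlike manifold. -/
def IsLightlikeSubmanifold [IsManifold I ∞ M] (g : BilinField J N) (i : M → N) : Prop :=
  IsLightlikeManifold I (pullback I J g i)

/-- The tangent space `T_p M` of the submanifold `i : M → N`, as a subspace of `T_{i(p)} N`. -/
def tangent (i : M → N) (p : M) : Submodule ℝ (TangentSpace J (i p)) :=
  LinearMap.range (mfderiv I J i p).toLinearMap

/-- The normal space `T_p M^⊥ ⊆ T_{i(p)} N` of the submanifold `i : M → N`. -/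
def normal (g : BilinField J N) (i : M → N) (p : M) : Submodule ℝ (TangentSpace J (i p)) :=
  orth J g (i p) (tangent I J i p)

/-- `S` is a screen distribution of the lightlike hypersurface `i : M → N`: a smooth vector bundle
with `TM = S ⊕ TM^⊥`. -/
def IsScreenDistribution [IsManifold J ∞ N] (g : BilinField J N) (i : M → N)
    (S : ∀ p : M, Submodule ℝ (TangentSpace J (i p))) : Prop :=
  IsSmoothSubbundle I J i S ∧
    ∀ p, S p ⊔ normal I J g i p = tangent I J i p ∧ Disjoint (S p) (normal I J g i p)

/-- A subbundle `S` of `TM ⊆ TN|_M` viewed as a distribution on `M`. -/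
def asDistribution (i : M → N) (S : ∀ p : M, Submodule ℝ (TangentSpace J (i p))) (p : M) :
    Submodule ℝ (TangentSpace I p) :=
  (S p).comap (mfderiv I J i p).toLinearMap

/-- `X` is, on `U`, a smooth non-vanishing field of null vectors along `i` that is orthogonal to `S`
and satisfies `g(ξ, X) = 1`. -/
def IsTransversalFieldOn [IsManifold J ∞ N] (g : BilinField J N) (i : M → N)
    (S : ∀ p : M, Submodule ℝ (TangentSpace J (i p)))
    (ξ X : ∀ p : M, TangentSpace J (i p)) (U : Set M) : Prop :=
  IsSmoothFieldOn I J i X U ∧ ∀ q ∈ U, X q ≠ 0 ∧ g (i q) (ξ q) (X q) = 1 ∧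
    g (i q) (X q) (X q) = 0 ∧ ∀ w ∈ S q, g (i q) w (X q) = 0

/-- `tr` is a lightlike transversal bundle associated with the screen distribution `S`: a smooth
line bundle with `TN|_M = TM ⊕ tr` such that each non-vanishing smooth local section `ξ` of `TM^⊥`
on an open set `U` determines near every point of `U` a unique section `X` of `tr` which is null,
orthogonal to `S`, and normalized by `g(ξ, X) = 1`. -/
def IsLightlikeTransversalBundle [IsManifold J ∞ N] (g : BilinField J N) (i : M → N)
    (S tr : ∀ p : M, Submodule ℝ (TangentSpace J (i p))) : Prop :=
  IsSmoothSubbundle I J i tr ∧ (∀ p, Module.finrank ℝ (tr p) = 1) ∧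
  (∀ p, IsCompl (tangent I J i p) (tr p)) ∧
  ∀ (U : Set M) (ξ : ∀ p : M, TangentSpace J (i p)), IsOpen U → IsSmoothFieldOn I J i ξ U →
    (∀ q ∈ U, ξ q ∈ normal I J g i q ∧ ξ q ≠ 0) →
    ∀ p ∈ U, ∃ U' ⊆ U, IsOpen U' ∧ p ∈ U' ∧ ∃ X : ∀ p : M, TangentSpace J (i p),
      (IsTransversalFieldOn I J g i S ξ X U' ∧ ∀ q ∈ U', X q ∈ tr q) ∧
      ∀ X' : ∀ p : M, TangentSpace J (i p),
        (IsTransversalFieldOn I J g i S ξ X' U' ∧ ∀ q ∈ U', X' q ∈ tr q) →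
        ∀ q ∈ U', X' q = X q

end General

/-! ### Monge-type hypersurfaces -/

section Monge

variable {E : Type*} [NormedAddCommGroup E] [NormedSpace ℝ E]
  {M : Type*} [TopologicalSpace M] [ChartedSpace E M]

/-- The form `dt ⊗ dt` on `ℝ`. -/
def dtSq : BilinField 𝓘(ℝ, ℝ) ℝ := fun _ => ContinuousLinearMap.mul ℝ ℝ

lemma dtSq_apply (t : ℝ) (a b : ℝ) : dtSq t a b = a * b := rfl

lemma isSmooth_dtSq : IsSmoothBilinField 𝓘(ℝ, ℝ) dtSq := by
  intro t₀
  refine (contMDiffAt_hom_bundle _).2 ⟨contMDiffAt_id, ?_⟩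
  refine (contMDiffAt_const (c := ContinuousLinearMap.mul ℝ ℝ)).congr_of_eventuallyEq ?_
  refine Filter.Eventually.of_forall fun t => ?_
  ext
  have e1 := inCoordinates_apply_eq₂ (𝕜 := ℝ) (F₁ := ℝ) (F₂ := ℝ) (F₃ := ℝ)
    (E₁ := (TangentSpace 𝓘(ℝ, ℝ) : ℝ → Type _)) (E₂ := (TangentSpace 𝓘(ℝ, ℝ) : ℝ → Type _))
    (E₃ := Bundle.Trivial ℝ ℝ) (x₀ := t₀) (x := t) (ϕ := dtSq t) (v := 1) (w := 1)
    (by simp [chartAt_self_eq]) (by simp [chartAt_self_eq]) (Set.mem_univ _)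
  refine e1.trans ?_
  have e2 := TangentBundle.symmL_model_space (𝕜 := ℝ) (F := ℝ) t₀ t
  have e3 : (trivializationAt ℝ (TangentSpace 𝓘(ℝ, ℝ)) t₀).symm t (1 : ℝ) = (1 : ℝ) := by
    rw [← Bundle.Trivialization.symmL_apply (R := ℝ) _ (by simp [chartAt_self_eq]), e2]
    rfl
  rw [e3]
  simp [dtSq]
  exact mul_one (1 : ℝ)

/-- The ambient form `-dx⁰ ⊗ dx⁰ + π^* g` on `ℝ × M`. -/
def ambientForm (g : BilinField 𝓘(ℝ, E) M) : BilinField (𝓘(ℝ, ℝ).prod 𝓘(ℝ, E)) (ℝ × M) :=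
  fun x => - pullback (𝓘(ℝ, ℝ).prod 𝓘(ℝ, E)) 𝓘(ℝ, ℝ) dtSq Prod.fst x +
    pullback (𝓘(ℝ, ℝ).prod 𝓘(ℝ, E)) 𝓘(ℝ, E) g Prod.snd x

lemma ambientForm_apply (g : BilinField 𝓘(ℝ, E) M) (x : ℝ × M) (u v : ℝ × E) :
    ambientForm g x u v = -(u.1 * v.1) + g x.2 u.2 v.2 := by
  simp only [ambientForm, pullback, mfderiv_fst, mfderiv_snd]
  rfl

lemma signature_prod (B : E →L[ℝ] E →L[ℝ] ℝ) {p q : ℕ} (b : Module.Basis (Fin p ⊕ Fin q) ℝ E)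
    (hb : ∀ i j, B (b i) (b j) = if i = j then Sum.elim (fun _ => -1) (fun _ => 1) i else 0) :
    ∃ b : Module.Basis (Fin (1 + p) ⊕ Fin q) ℝ (ℝ × E), ∀ i j,
      -((b i).1 * (b j).1) + B (b i).2 (b j).2 =
      if i = j then Sum.elim (fun _ => -1) (fun _ => 1) i else 0 := by
  let e : Fin 1 ⊕ (Fin p ⊕ Fin q) ≃ Fin (1 + p) ⊕ Fin q :=
    (Equiv.sumAssoc _ _ _).symm.trans (Equiv.sumCongr finSumFinEquiv (Equiv.refl _))
  refine ⟨((Module.Basis.singleton (Fin 1) ℝ).prod b).reindex e, fun i j => ?_⟩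
  obtain ⟨i, rfl⟩ := e.surjective i
  obtain ⟨j, rfl⟩ := e.surjective j
  simp only [e.injective.eq_iff, Module.Basis.reindex_apply, Equiv.symm_apply_apply]
  rcases i with i | i | i <;> rcases j with j | j | j <;> simp [hb, e]
  exact (Subsingleton.elim i j)

/-- The ambient semi-Riemannian manifold `(ℝ × M, -dx⁰ ⊗ dx⁰ + π^* g)`. -/
def ambientMetric [IsManifold 𝓘(ℝ, E) ∞ M] (g : SemiRiemannianMetric 𝓘(ℝ, E) M) :
    SemiRiemannianMetric (𝓘(ℝ, ℝ).prod 𝓘(ℝ, E)) (ℝ × M) where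
  form := ambientForm g.form
  symm x u v := by
    refine (ambientForm_apply _ _ _ _).trans (Eq.trans ?_ (ambientForm_apply _ _ _ _).symm)
    exact congrArg₂ (fun a b : ℝ => -a + b) (mul_comm _ _) (g.symm _ _ _)
  nondegenerate x (u : ℝ × E) hu := by
    have h : ∀ v : ℝ × E, -(u.1 * v.1) + g.form x.2 u.2 v.2 = 0 := fun v =>
      (ambientForm_apply _ _ _ _).symm.trans (hu v)
    refine Prod.ext ?_ (g.nondegenerate x.2 u.2 fun v => ?_)
    · have h1 := h ((1 : ℝ), (0 : E))
      have h0 : g.form x.2 u.2 (0 : E) = 0 := map_zero (g.form x.2 u.2)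
      change -(u.1 * 1) + g.form x.2 u.2 (0 : E) = 0 at h1
      change u.1 = (0 : ℝ)
      linarith
    · have h1 := h ((0 : ℝ), v)
      change -(u.1 * 0) + g.form x.2 u.2 v = 0 at h1
      linarith
  signature := by
    obtain ⟨p, q, h⟩ := g.signature
    refine ⟨1 + p, q, fun x => ?_⟩
    obtain ⟨b, hb⟩ := h x.2
    obtain ⟨b', hb'⟩ := signature_prod (E := E) (g.form x.2) b hb
    exact ⟨b', fun i j => (ambientForm_apply _ _ _ _).trans (hb' i j)⟩
  smooth := (isSmooth_dtSq.pullback _ _ contMDiff_fst).neg.add (g.smooth.pullback _ _ contMDiff_snd)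

/-- The Monge-type hypersurface `{(t, p) ∈ ℝ × M | t = F(p)}`. -/
def Hypersurface (F : C^∞⟮𝓘(ℝ, E), M; 𝓘(ℝ, ℝ), ℝ⟯) : Type _ := {x : ℝ × M // x.1 = F x.2}

namespace Hypersurface

variable (F : C^∞⟮𝓘(ℝ, E), M; 𝓘(ℝ, ℝ), ℝ⟯)

/-- The hypersurface carries the subspace topology. -/
instance : TopologicalSpace (Hypersurface F) := instTopologicalSpaceSubtype

/-- The inclusion of the hypersurface into the ambient space. -/
def incl (x : Hypersurface F) : ℝ × M := x.1

/-- The projection of the graph onto `M` is a homeomorphism. -/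
def homeo : Hypersurface F ≃ₜ M where
  toFun x := x.1.2
  invFun p := ⟨(F p, p), rfl⟩
  left_inv x := Subtype.ext (Prod.ext x.2.symm rfl)
  right_inv _ := rfl
  continuous_toFun := continuous_snd.comp continuous_subtype_val
  continuous_invFun := (F.contMDiff.continuous.prodMk continuous_id).subtype_mk _

/-- The smooth structure of the hypersurface: its charts are the charts of `M` composed with the
projection. It makes the inclusion a smooth embedding, see the lemmas below. -/
instance : ChartedSpace E (Hypersurface F) where
  atlas := {e | ∃ c ∈ atlas E M, e = (homeo F).toOpenPartialHomeomorph.trans c}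
  chartAt x := (homeo F).toOpenPartialHomeomorph.trans (chartAt E (homeo F x))
  mem_chart_source x := by simp
  chart_mem_atlas x := ⟨_, chart_mem_atlas _ _, rfl⟩

lemma chartAt_eq (x : Hypersurface F) :
    chartAt E x = (homeo F).toOpenPartialHomeomorph.trans (chartAt E (homeo F x)) := rfl

instance [IsManifold 𝓘(ℝ, E) ∞ M] : IsManifold 𝓘(ℝ, E) ∞ (Hypersurface F) where
  compatible := by
    rintro _ _ ⟨c, hc, rfl⟩ ⟨c', hc', rfl⟩
    refine (contDiffGroupoid ∞ 𝓘(ℝ, E)).mem_of_eqOnSource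
      (HasGroupoid.compatible (G := contDiffGroupoid ∞ 𝓘(ℝ, E)) hc hc') ?_
    refine ⟨?_, fun y _ => ?_⟩
    · ext y
      simp
    · simp

lemma contMDiff_homeo : ContMDiff 𝓘(ℝ, E) 𝓘(ℝ, E) ∞ (homeo F) := by
  intro x
  refine contMDiffAt_iff.2 ⟨(homeo F).continuous.continuousAt, ?_⟩
  refine contDiffWithinAt_id.congr_of_eventuallyEq ?_ ?_
  · have h : (extChartAt 𝓘(ℝ, E) (homeo F x)).target ∈
        𝓝[Set.range 𝓘(ℝ, E)] (extChartAt 𝓘(ℝ, E) x x) :=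
      extChartAt_target_mem_nhdsWithin (I := 𝓘(ℝ, E)) (homeo F x)
    filter_upwards [h] with y hy
    simpa [chartAt_eq] using (extChartAt 𝓘(ℝ, E) (homeo F x)).right_inv hy
  · simp [chartAt_eq]

lemma contMDiff_homeo_symm : ContMDiff 𝓘(ℝ, E) 𝓘(ℝ, E) ∞ (homeo F).symm := by
  intro x
  refine contMDiffAt_iff.2 ⟨(homeo F).symm.continuous.continuousAt, ?_⟩
  refine contDiffWithinAt_id.congr_of_eventuallyEq ?_ ?_
  · have h : (extChartAt 𝓘(ℝ, E) x).target ∈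
        𝓝[Set.range 𝓘(ℝ, E)] (extChartAt 𝓘(ℝ, E) x x) :=
      extChartAt_target_mem_nhdsWithin (I := 𝓘(ℝ, E)) x
    filter_upwards [h] with y hy
    simpa [chartAt_eq] using (extChartAt 𝓘(ℝ, E) x).right_inv hy
  · simp [chartAt_eq]

lemma isEmbedding_incl : Topology.IsEmbedding (incl F) := Topology.IsEmbedding.subtypeVal

lemma contMDiff_incl : ContMDiff 𝓘(ℝ, E) (𝓘(ℝ, ℝ).prod 𝓘(ℝ, E)) ∞ (incl F) := by
  have h := (F.contMDiff.comp (contMDiff_homeo F)).prodMk (contMDiff_homeo F)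
  refine h.congr fun x => ?_
  exact Prod.ext x.2 rfl

lemma injective_mfderiv_incl (x : Hypersurface F) :
    Function.Injective (mfderiv 𝓘(ℝ, E) (𝓘(ℝ, ℝ).prod 𝓘(ℝ, E)) (incl F) x) := by
  let r : ℝ × M → Hypersurface F := fun y => (homeo F).symm y.2
  have hr : ContMDiff (𝓘(ℝ, ℝ).prod 𝓘(ℝ, E)) 𝓘(ℝ, E) ∞ r :=
    (contMDiff_homeo_symm F).comp contMDiff_snd
  have hri : r ∘ incl F = id := funext fun x => (homeo F).symm_apply_apply x
  have h := mfderiv_comp x (hr.mdifferentiable (by simp) (incl F x))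
    ((contMDiff_incl F).mdifferentiable (by simp) x)
  rw [hri, mfderiv_id] at h
  intro u v huv
  have hu := DFunLike.congr_fun h u
  have hv := DFunLike.congr_fun h v
  exact hu.trans ((congrArg (mfderiv (𝓘(ℝ, ℝ).prod 𝓘(ℝ, E)) 𝓘(ℝ, E) r (incl F x)) huv).trans
    hv.symm)

end Hypersurface

/-- The coordinate vector field `∂₀ = ∂/∂x⁰` on `ℝ × M`. -/
def d0 (x : ℝ × M) : TangentSpace (𝓘(ℝ, ℝ).prod 𝓘(ℝ, E)) x :=
  mfderiv 𝓘(ℝ, ℝ) (𝓘(ℝ, ℝ).prod 𝓘(ℝ, E)) (fun t : ℝ => (t, x.2)) x.1 (1 : ℝ)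

/-- The lift `X_L` to `ℝ × M` of a vector field `X` on `M`. -/
def lift (X : ∀ p : M, TangentSpace 𝓘(ℝ, E) p) (x : ℝ × M) :
    TangentSpace (𝓘(ℝ, ℝ).prod 𝓘(ℝ, E)) x :=
  mfderiv 𝓘(ℝ, E) (𝓘(ℝ, ℝ).prod 𝓘(ℝ, E)) (fun p : M => (x.1, p)) x.2 (X x.2)

variable [IsManifold 𝓘(ℝ, E) ∞ M] [FiniteDimensional ℝ E]
  (g : SemiRiemannianMetric 𝓘(ℝ, E) M) (F : C^∞⟮𝓘(ℝ, E), M; 𝓘(ℝ, ℝ), ℝ⟯)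

/-- The vector field `ξ = ∂₀ + (grad F)_L` on `ℝ × M`. -/
def xi (x : ℝ × M) : TangentSpace (𝓘(ℝ, ℝ).prod 𝓘(ℝ, E)) x :=
  d0 x + lift (g.grad F) x

/-- The vector field `N_ξ = -½ (∂₀ - (grad F)_L)` on `ℝ × M`. -/
def transversalField (x : ℝ × M) : TangentSpace (𝓘(ℝ, ℝ).prod 𝓘(ℝ, E)) x :=
  (-(1 / 2) : ℝ) • (d0 x - lift (g.grad F) x)

/-- The canonical screen `(span {ξ, ∂₀})^⊥` along the hypersurface. -/
def canonicalScreen (p : Hypersurface F) :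
    Submodule ℝ (TangentSpace (𝓘(ℝ, ℝ).prod 𝓘(ℝ, E)) (Hypersurface.incl F p)) :=
  orth (𝓘(ℝ, ℝ).prod 𝓘(ℝ, E)) (ambientMetric g).form (Hypersurface.incl F p)
    (Submodule.span ℝ {xi g F (Hypersurface.incl F p), d0 (Hypersurface.incl F p)})

/-- The line spanned by `N_ξ` along the hypersurface. -/
def transversalLine (p : Hypersurface F) :
    Submodule ℝ (TangentSpace (𝓘(ℝ, ℝ).prod 𝓘(ℝ, E)) (Hypersurface.incl F p)) :=
  Submodule.span ℝ {transversalField g F (Hypersurface.incl F p)}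

end Monge

end LightlikeGeometry

namespace LightlikeGeometry

/-! ### Smooth vector fields along maps -/

section SmoothFields

variable {E : Type*} [NormedAddCommGroup E] [NormedSpace ℝ E]
  {H : Type*} [TopologicalSpace H] {I : ModelWithCorners ℝ E H}
  {M : Type*} [TopologicalSpace M] [ChartedSpace H M]
  {E' : Type*} [NormedAddCommGroup E'] [NormedSpace ℝ E']
  {H' : Type*} [TopologicalSpace H'] {J : ModelWithCorners ℝ E' H'}
  {N : Type*} [TopologicalSpace N] [ChartedSpace H' N]

/-! Identify the ambient tangent space with `ℝ × E`, where the metric is `-ab + g(v, w)`, and write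
`n` for the gradient of `F`, so that `ξ = (1, n)` and `N_ξ = (-1/2, n/2)`. The tangent space of the
graph is `{(g(n, v), v)}`, which is the orthogonal space of `ξ`, and the normal space is the line of
`ξ` (`mem_tangent_incl`, `mem_normal_incl`). A nonzero radical vector is pushed forward to a nonzero
multiple of `ξ`, which is therefore tangent. Hence degeneracy forces `g(n, n) = 1`
(`formAt_gradAt_self`), and all the pointwise claims become linear algebra with a unit vector `n`.

The screen is `{(0, v) : g(n, v) = 0}` (`mem_canonicalScreen`). These are the tangent vectors
without time component, so the screen is the kernel of the differential of the height function `x⁰`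
restricted to the hypersurface (`asDistribution_canonicalScreen`). That function has no critical
points, again because `n` is a unit vector. Smoothness, involutivity and integrability of the screen
are thus instances of general facts about `ker df`: `isSmoothSubbundle_dker`, `isInvolutive_dker`,
and `isIntegrable_dker`, whose integral manifolds are level sets obtained from the inverse function
theorem.

For the transversal bundle, a vector orthogonal to the screen has the form `(a, b n)`. Being null
and pairing to `1` with `ξ` leaves only `a = -1/2`, `b = 1/2` (`eq_transversalField`). Since `ξ` is
a global section of the normal bundle, this fixes the bundle everywhere. Smoothness of `ξ`, hence of
`N_ξ`, is read off from a smooth local frame of the radical distribution (`isSmoothFieldOn_xi`). -/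

lemma IsSmoothFieldOn.mono [IsManifold J ∞ N] {f : M → N} {X : ∀ p : M, TangentSpace J (f p)}
    {U V : Set M} (hX : IsSmoothFieldOn I J f X U) (h : V ⊆ U) : IsSmoothFieldOn I J f X V :=
  ContMDiffOn.mono hX h

lemma IsSmoothFieldOn.congr [IsManifold J ∞ N] {f : M → N} {X Y : ∀ p : M, TangentSpace J (f p)}
    {U : Set M} (hX : IsSmoothFieldOn I J f X U) (h : ∀ p ∈ U, Y p = X p) :
    IsSmoothFieldOn I J f Y U :=
  ContMDiffOn.congr hX fun p hp => by rw [h p hp]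

/-- The fields live over `f`, not over the identity, so smoothness is tested in the trivialization
of `TN` at `f p`, which is linear on the fibres over its base set. -/
lemma IsSmoothFieldOn.smul_add_smul [IsManifold J ∞ N] {f : M → N}
    {X Y : ∀ p : M, TangentSpace J (f p)} {U : Set M} {a b : M → ℝ}
    (ha : ContMDiffOn I 𝓘(ℝ, ℝ) ∞ a U) (hX : IsSmoothFieldOn I J f X U)
    (hb : ContMDiffOn I 𝓘(ℝ, ℝ) ∞ b U) (hY : IsSmoothFieldOn I J f Y U) :
    IsSmoothFieldOn I J f (fun p => a p • X p + b p • Y p) U := by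
  intro p hp
  have hX' := Bundle.contMDiffWithinAt_totalSpace.1 (hX p hp)
  have hY' := Bundle.contMDiffWithinAt_totalSpace.1 (hY p hp)
  refine Bundle.contMDiffWithinAt_totalSpace.2 ⟨hX'.1, ?_⟩
  have h := ((ha p hp).smul hX'.2).add ((hb p hp).smul hY'.2)
  have hb : ∀ᶠ q in 𝓝[U] p, f q ∈ (trivializationAt E' (TangentSpace J) (f p)).baseSet :=
    hX'.1.continuousWithinAt ((trivializationAt E' (TangentSpace J) (f p)).open_baseSet.mem_nhds
      (FiberBundle.mem_baseSet_trivializationAt' (f p)))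
  have key : ∀ q, f q ∈ (trivializationAt E' (TangentSpace J) (f p)).baseSet →
      (trivializationAt E' (TangentSpace J) (f p) ⟨f q, a q • X q + b q • Y q⟩).2 =
      a q • (trivializationAt E' (TangentSpace J) (f p) ⟨f q, X q⟩).2 +
      b q • (trivializationAt E' (TangentSpace J) (f p) ⟨f q, Y q⟩).2 := by
    intro q hq
    have hl := (trivializationAt E' (TangentSpace J) (f p)).linear ℝ hq
    exact (hl.map_add _ _).trans (congrArg₂ (· + ·) (hl.map_smul _ _) (hl.map_smul _ _))
  refine h.congr_of_eventuallyEq (hb.mono fun q hq => key q hq) ?_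
  exact key p (FiberBundle.mem_baseSet_trivializationAt' (f p))

lemma IsSmoothFieldOn.smul [IsManifold J ∞ N] {f : M → N}
    {X : ∀ p : M, TangentSpace J (f p)} {U : Set M} {a : M → ℝ}
    (ha : ContMDiffOn I 𝓘(ℝ, ℝ) ∞ a U) (hX : IsSmoothFieldOn I J f X U) :
    IsSmoothFieldOn I J f (fun p => a p • X p) U :=
  (IsSmoothFieldOn.smul_add_smul ha hX (contMDiffOn_const (c := (0 : ℝ))) hX).congr
    fun p _ => by simp

/-- The image of a smooth field along a map under the differential of a smooth map. -/
lemma IsSmoothFieldOn.mfderiv_comp_apply {E'' : Type*} [NormedAddCommGroup E'']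
    [NormedSpace ℝ E''] {H'' : Type*} [TopologicalSpace H''] {K : ModelWithCorners ℝ E'' H''}
    {P : Type*} [TopologicalSpace P] [ChartedSpace H'' P] [IsManifold J ∞ N] [IsManifold K ∞ P]
    {f : M → N} {h : N → P} (hh : ContMDiff J K ∞ h) {X : ∀ p : M, TangentSpace J (f p)}
    {U : Set M} (hX : IsSmoothFieldOn I J f X U) :
    IsSmoothFieldOn I K (fun p => h (f p)) (fun p => mfderiv J K h (f p) (X p)) U :=
  (hh.contMDiff_tangentMap (m := ∞) (by simp)).comp_contMDiffOn hX

/-- The image of a smooth field under the differential of a smooth map. -/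
lemma IsSmoothFieldOn.mfderiv_apply [IsManifold I ∞ M] [IsManifold J ∞ N] {f : M → N}
    (hf : ContMDiff I J ∞ f) {X : ∀ p : M, TangentSpace I p} {U : Set M}
    (hX : IsSmoothFieldOn I I (fun p => p) X U) :
    IsSmoothFieldOn I J f (fun p => mfderiv I J f p (X p)) U :=
  hX.mfderiv_comp_apply hf

lemma IsSmoothFieldOn.contMDiffOn_of_real {f : M → ℝ} {X : ∀ p : M, TangentSpace 𝓘(ℝ, ℝ) (f p)}
    {U : Set M} (hX : IsSmoothFieldOn I 𝓘(ℝ, ℝ) f X U) :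
    ContMDiffOn I 𝓘(ℝ, ℝ) ∞ (fun p => (X p : ℝ)) U :=
  (contMDiff_snd_tangentBundle_modelSpace ℝ 𝓘(ℝ, ℝ)).comp_contMDiffOn hX

/-- The derivative of a smooth function along a smooth vector field is smooth. -/
lemma IsSmoothFieldOn.contMDiffOn_mfderiv_apply [IsManifold I ∞ M] {f : M → ℝ}
    (hf : ContMDiff I 𝓘(ℝ, ℝ) ∞ f) {X : ∀ p : M, TangentSpace I p} {U : Set M}
    (hX : IsSmoothFieldOn I I (fun p => p) X U) :
    ContMDiffOn I 𝓘(ℝ, ℝ) ∞ (fun p => (mfderiv I 𝓘(ℝ, ℝ) f p (X p) : ℝ)) U :=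
  (hX.mfderiv_apply hf).contMDiffOn_of_real

end SmoothFields

/-! ### The distribution `ker df`: involutivity, smooth frames, integral manifolds -/

section Kernel

variable {E : Type*} [NormedAddCommGroup E] [NormedSpace ℝ E]
  {M : Type*} [TopologicalSpace M] [ChartedSpace E M]

/-- The kernel of the differential of a function. -/
def dker (f : M → ℝ) (p : M) : Submodule ℝ (TangentSpace 𝓘(ℝ, E) p) :=
  LinearMap.ker (mfderiv 𝓘(ℝ, E) 𝓘(ℝ, ℝ) f p).toLinearMap

lemma mem_dker {f : M → ℝ} {p : M} {v : TangentSpace 𝓘(ℝ, E) p} :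
    v ∈ dker f p ↔ mfderiv 𝓘(ℝ, E) 𝓘(ℝ, ℝ) f p v = 0 := Iff.rfl

lemma two_le_infty : (2 : WithTop ℕ∞) ≤ ∞ := by
  exact WithTop.coe_le_coe.2 (le_top : (2 : ℕ∞) ≤ ⊤)

lemma exists_mfderiv_eq_one {f : M → ℝ} {p : M} (hf : mfderiv 𝓘(ℝ, E) 𝓘(ℝ, ℝ) f p ≠ 0) :
    ∃ v : E, (mfderiv 𝓘(ℝ, E) 𝓘(ℝ, ℝ) f p v : ℝ) = 1 := by
  obtain ⟨v, hv⟩ : ∃ v : E, (mfderiv 𝓘(ℝ, E) 𝓘(ℝ, ℝ) f p v : ℝ) ≠ 0 := by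
    by_contra! h
    exact hf (ContinuousLinearMap.ext h)
  let L : E →L[ℝ] ℝ := mfderiv 𝓘(ℝ, E) 𝓘(ℝ, ℝ) f p
  refine ⟨(L v)⁻¹ • v, ?_⟩
  change L ((L v)⁻¹ • v) = 1
  rw [map_smul, smul_eq_mul]
  exact inv_mul_cancel₀ hv

lemma finrank_ker_add_one {V : Type*} [AddCommGroup V] [Module ℝ V] [FiniteDimensional ℝ V]
    {L : V →ₗ[ℝ] ℝ} (hL : L ≠ 0) :
    Module.finrank ℝ (LinearMap.ker L) + 1 = Module.finrank ℝ V :=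
  Module.Dual.finrank_ker_add_one_of_ne_zero hL

lemma finrank_dker [FiniteDimensional ℝ E] {f : M → ℝ} {p : M}
    (hf : mfderiv 𝓘(ℝ, E) 𝓘(ℝ, ℝ) f p ≠ 0) :
    Module.finrank ℝ (dker (E := E) f p) + 1 = Module.finrank ℝ E := by
  let L : E →L[ℝ] ℝ := mfderiv 𝓘(ℝ, E) 𝓘(ℝ, ℝ) f p
  have hL : L.toLinearMap ≠ 0 := fun h => hf (ContinuousLinearMap.ext fun v =>
    LinearMap.congr_fun h v)
  exact finrank_ker_add_one (V := E) hL

/-- The kernel of the differential of a smooth function is involutive. -/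
lemma isInvolutive_dker [FiniteDimensional ℝ E] [IsManifold 𝓘(ℝ, E) ∞ M] {f : M → ℝ}
    (hf : ContMDiff 𝓘(ℝ, E) 𝓘(ℝ, ℝ) ∞ f) : IsInvolutive 𝓘(ℝ, E) (dker (E := E) f) := by
  intro U X Y hU hX hY hXD hYD p hp
  have : IsManifold 𝓘(ℝ, E) 2 M := IsManifold.of_le (n := ∞) two_le_infty
  have : IsManifold 𝓘(ℝ, E) 1 M := IsManifold.of_le (n := ∞) (by simp)
  let c := extChartAt 𝓘(ℝ, E) p
  let h : E → ℝ := f ∘ c.symm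
  have hct : c.target ∈ 𝓝 (c p) := extChartAt_target_mem_nhds p
  have hcs : ContMDiffOn 𝓘(ℝ, E) 𝓘(ℝ, E) ∞ c.symm c.target := contMDiffOn_extChartAt_symm p
  have hh : ContDiffAt ℝ 2 h (c p) :=
    (((hf.comp_contMDiffOn hcs).contDiffOn).contDiffAt hct).of_le two_le_infty
  -- In the chart, the pulled-back field is annihilated by `dh` on a whole neighbourhood, because
  -- the differential of `c.symm` undoes the pullback. An identity at the single point `c p` could
  -- not be differentiated.
  have key : ∀ Z : ∀ q : M, TangentSpace 𝓘(ℝ, E) q, (∀ q ∈ U, Z q ∈ dker (E := E) f q) →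
      (fun y => fderiv ℝ h y (VectorField.mpullbackWithin 𝓘(ℝ, E) 𝓘(ℝ, E) c.symm Z
        (Set.range 𝓘(ℝ, E)) y)) =ᶠ[𝓝 (c p)] fun _ => (0 : ℝ) := by
    intro Z hZ
    have hUc : c.symm ⁻¹' U ∈ 𝓝 (c p) := by
      refine (continuousAt_extChartAt_symm p).preimage_mem_nhds (hU.mem_nhds ?_)
      rwa [extChartAt_to_inv]
    filter_upwards [eventually_mem_nhds_iff.2 hct, hUc] with y hy hyU
    have hyt := mem_of_mem_nhds hy
    have hi := isInvertible_mfderivWithin_extChartAt_symm (I := 𝓘(ℝ, E)) hyt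
    have hd : MDifferentiableAt 𝓘(ℝ, E) 𝓘(ℝ, E) c.symm y :=
      (hcs.contMDiffAt hy).mdifferentiableAt (by simp)
    rw [← mfderiv_eq_fderiv]
    simp only [h]
    rw [mfderiv_comp y (hf.mdifferentiable (by simp) _) hd]
    simp only [VectorField.mpullbackWithin_apply]
    have hr : Set.range 𝓘(ℝ, E) = Set.univ := by simp
    rw [hr, mfderivWithin_univ] at hi ⊢
    have e := hi.self_apply_inverse (Z (c.symm y))
    exact (congrArg (mfderiv 𝓘(ℝ, E) 𝓘(ℝ, ℝ) f (c.symm y)) e).trans (hZ _ hyU)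
  have hs : c.symm ⁻¹' Set.univ ∩ Set.range 𝓘(ℝ, E) = Set.univ := by simp
  have hdiff : ∀ Z : ∀ q : M, TangentSpace 𝓘(ℝ, E) q,
      IsSmoothFieldOn 𝓘(ℝ, E) 𝓘(ℝ, E) (fun p => p) Z U →
      DifferentiableAt ℝ (VectorField.mpullbackWithin 𝓘(ℝ, E) 𝓘(ℝ, E) c.symm Z
        (Set.range 𝓘(ℝ, E))) (c p) := by
    intro Z hZ
    have h1 : MDifferentiableAt 𝓘(ℝ, E) 𝓘(ℝ, E).tangent
        (fun q => (⟨q, Z q⟩ : TangentBundle 𝓘(ℝ, E) M)) p :=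
      (ContMDiffOn.contMDiffAt hZ (hU.mem_nhds hp)).mdifferentiableAt (by simp)
    have h2 := MDifferentiableWithinAt.differentiableWithinAt_mpullbackWithin_vectorField
      h1.mdifferentiableWithinAt (s := Set.univ)
    rw [hs] at h2
    exact differentiableWithinAt_univ.1 h2
  have hsymm : IsSymmSndFDerivAt ℝ h (c p) := hh.isSymmSndFDerivAt (by simp)
  -- By symmetry of the second derivative, `dh` of the bracket is a difference of derivatives of the
  -- functions `dh(X)` and `dh(Y)`. Both functions vanish near `c p`.
  have hbr := VectorField.fderiv_apply_lieBracket_of_isSymmSndFDerivAt hh hsymm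
    (hdiff Y hY) (hdiff X hX)
  rw [(key X hXD).fderiv_eq, (key Y hYD).fderiv_eq] at hbr
  rw [mem_dker]
  have hfc : f =ᶠ[𝓝 p] h ∘ c := by
    filter_upwards [extChartAt_source_mem_nhds (I := 𝓘(ℝ, E)) p] with q hq
    simp [h, c.left_inv hq]
  have hc : MDifferentiableAt 𝓘(ℝ, E) 𝓘(ℝ, E) c p :=
    mdifferentiableAt_extChartAt (mem_chart_source E p)
  have hci := isInvertible_mfderiv_extChartAt (I := 𝓘(ℝ, E)) (mem_extChartAt_source p)
  rw [hfc.mfderiv_eq, mfderiv_comp p (hh.differentiableAt (by simp)).mdifferentiableAt hc,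
    mfderiv_eq_fderiv, VectorField.mlieBracket, VectorField.mlieBracketWithin_apply]
  refine (congrArg (fderiv ℝ h (c p)) (hci.self_apply_inverse _)).trans ?_
  have e : ∀ V W : E → E, VectorField.lieBracketWithin ℝ V W
      (c.symm ⁻¹' Set.univ ∩ Set.range 𝓘(ℝ, E)) (c p) = VectorField.lieBracket ℝ V W (c p) := by
    intro V W
    rw [hs, VectorField.lieBracketWithin_univ]
  refine (congrArg (fderiv ℝ h (c p)) (e _ _)).trans (hbr.trans ?_)
  rw [fderiv_fun_const]
  exact sub_self (0 : ℝ)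

/-- The smooth local vector field which is constant in a trivialization of the tangent bundle. -/
lemma isSmoothFieldOn_trivializationAt_symm [IsManifold 𝓘(ℝ, E) ∞ M] (p : M) (v : E) :
    IsSmoothFieldOn 𝓘(ℝ, E) 𝓘(ℝ, E) (fun q => q)
      (fun q => (trivializationAt E (TangentSpace 𝓘(ℝ, E)) p).symm q v)
      (trivializationAt E (TangentSpace 𝓘(ℝ, E) : M → Type _) p).baseSet := by
  intro q hq
  let e := trivializationAt E (TangentSpace 𝓘(ℝ, E) : M → Type _) p
  refine (e.contMDiffWithinAt_iff (e.mem_source.2 hq)).2 ⟨contMDiffWithinAt_id, ?_⟩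
  refine (contMDiffWithinAt_const (c := v)).congr (fun y hy => ?_) ?_
  · exact congrArg Prod.snd (e.apply_mk_symm hy v)
  · exact congrArg Prod.snd (e.apply_mk_symm hq v)

/-- The projection `x ↦ x - L x • v` kills `v` and fixes every `w i`, so it sends the corrected
family back to `w`. -/
lemma linearIndependent_sub_smul {V ι : Type*} [AddCommGroup V] [Module ℝ V] {L : V →ₗ[ℝ] ℝ}
    {v : V} (hv : L v = 1) {w : ι → V} (hw : ∀ i, L (w i) = 0) (hli : LinearIndependent ℝ w)
    (c : ι → ℝ) : LinearIndependent ℝ fun i => w i - c i • v := by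
  let P : V →ₗ[ℝ] V := LinearMap.id - L.smulRight v
  refine LinearIndependent.of_comp P ?_
  convert hli using 1
  ext i
  simp [P, hv, hw]

/-- The kernel of the differential of a smooth function without critical points is a smooth
distribution. -/
lemma isSmoothSubbundle_dker [FiniteDimensional ℝ E] [IsManifold 𝓘(ℝ, E) ∞ M] {f : M → ℝ}
    (hf : ContMDiff 𝓘(ℝ, E) 𝓘(ℝ, ℝ) ∞ f) (hd : ∀ p, mfderiv 𝓘(ℝ, E) 𝓘(ℝ, ℝ) f p ≠ 0) :
    IsSmoothSubbundle 𝓘(ℝ, E) 𝓘(ℝ, E) (fun p => p) (dker (E := E) f) := by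
  intro p
  let e := trivializationAt E (TangentSpace 𝓘(ℝ, E) : M → Type _) p
  have hpe : p ∈ e.baseSet := FiberBundle.mem_baseSet_trivializationAt' p
  let s : E → ∀ q : M, TangentSpace 𝓘(ℝ, E) q := fun v q => e.symm q v
  have hs : ∀ v, IsSmoothFieldOn 𝓘(ℝ, E) 𝓘(ℝ, E) (fun q => q) (s v) e.baseSet :=
    isSmoothFieldOn_trivializationAt_symm p
  let d : E → M → ℝ := fun v q => mfderiv 𝓘(ℝ, E) 𝓘(ℝ, ℝ) f q (s v q)
  have hds : ∀ v, ContMDiffOn 𝓘(ℝ, E) 𝓘(ℝ, ℝ) ∞ (d v) e.baseSet := fun v =>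
    (hs v).contMDiffOn_mfderiv_apply hf
  let T : ∀ q ∈ e.baseSet, E ≃ₗ[ℝ] E := fun q hq => (e.linearEquivAt ℝ q hq).symm
  let L : E →ₗ[ℝ] ℝ :=
    (mfderiv 𝓘(ℝ, E) 𝓘(ℝ, ℝ) f p : E →L[ℝ] ℝ).toLinearMap.comp (T p hpe).toLinearMap
  obtain ⟨v, hv⟩ : ∃ v, L v = 1 := by
    obtain ⟨u, hu⟩ := exists_mfderiv_eq_one (hd p)
    obtain ⟨v, rfl⟩ := (T p hpe).surjective u
    exact ⟨v, hu⟩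
  have hL : L ≠ 0 := fun h => by simp [h] at hv
  let w := Module.finBasis ℝ (LinearMap.ker L)
  have hk := finrank_ker_add_one hL
  -- Extend a basis `w` of the kernel at `p` by fields constant in the trivialization. Where `df(s
  -- v)` is nonzero, subtracting the multiple `df(s (w i)) / df(s v)` of `s v` moves them into the
  -- kernel at `q`.
  refine ⟨e.baseSet ∩ {q | d v q ≠ 0},
    (hds v).continuousOn.isOpen_inter_preimage e.open_baseSet isOpen_ne,
    ⟨hpe, fun h => one_ne_zero (hv.symm.trans h)⟩, _,
    fun i q => (1 : ℝ) • s (w i) q + (-(d (w i) q / d v q)) • s v q, fun i => ?_, ?_⟩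
  · refine IsSmoothFieldOn.smul_add_smul contMDiffOn_const ((hs _).mono Set.inter_subset_left) ?_
      ((hs _).mono Set.inter_subset_left)
    exact ContMDiffOn.neg (((hds _).mono Set.inter_subset_left).div₀
      ((hds v).mono Set.inter_subset_left) fun q hq => hq.2)
  · rintro q ⟨hq, hqv⟩
    have heq : ∀ i, T q hq ((w i : E) - (d (w i) q / d v q) • v) =
        (1 : ℝ) • s (w i) q + (-(d (w i) q / d v q)) • s v q := fun i => by
      rw [map_sub, map_smul, one_smul, neg_smul, ← sub_eq_add_neg]
      rfl
    let Y : Fin (Module.finrank ℝ (LinearMap.ker L)) → E := fun i =>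
      (1 : ℝ) • s (w i) q + (-(d (w i) q / d v q)) • s v q
    have hli : LinearIndependent ℝ Y := by
      have h1 : LinearIndependent ℝ fun i => (w i : E) :=
        w.linearIndependent.map' (LinearMap.ker L).subtype (Submodule.ker_subtype _)
      have h2 := (linearIndependent_sub_smul hv (fun i => (w i).2) h1
        (fun i => d (w i) q / d v q)).map'
        (T q hq).toLinearMap (T q hq).ker
      rwa [show Y = _ from funext fun i => (heq i).symm]
    refine ⟨hli, ?_⟩
    have : FiniteDimensional ℝ (TangentSpace 𝓘(ℝ, E) q) := inferInstanceAs (FiniteDimensional ℝ E)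
    refine Submodule.eq_of_le_of_finrank_eq (Submodule.span_le.2 ?_) ?_
    · rintro _ ⟨i, rfl⟩
      have h : d (w i) q + -(d (w i) q / d v q) * d v q = 0 := by
        rw [neg_mul, div_mul_cancel₀ _ hqv, add_neg_cancel]
      let D : E →L[ℝ] ℝ := mfderiv 𝓘(ℝ, E) 𝓘(ℝ, ℝ) f q
      change D ((1 : ℝ) • s (w i) q + (-(d (w i) q / d v q)) • s v q) = 0
      have hD : ∀ (x y : E) (c : ℝ), D ((1 : ℝ) • x + c • y) = D x + c * D y := by simp
      exact (hD _ _ _).trans h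
    · exact (finrank_span_eq_card (R := ℝ) (M := E) hli).trans ((Fintype.card_fin _).trans
        (Nat.add_right_cancel (hk.trans (finrank_dker (E := E) (hd q)).symm)))

/-- Through each point there passes a level set of a smooth function without critical points. -/
lemma isIntegrable_dker [FiniteDimensional ℝ E] [IsManifold 𝓘(ℝ, E) ∞ M] {f : M → ℝ}
    (hf : ContMDiff 𝓘(ℝ, E) 𝓘(ℝ, ℝ) ∞ f) (hd : ∀ p, mfderiv 𝓘(ℝ, E) 𝓘(ℝ, ℝ) f p ≠ 0) :
    IsIntegrable 𝓘(ℝ, E) (dker (E := E) f) := by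
  intro p
  let c := extChartAt 𝓘(ℝ, E) p
  let a : E := c p
  let h : E → ℝ := f ∘ c.symm
  have hct : IsOpen c.target := isOpen_extChartAt_target p
  have hat : a ∈ c.target := mem_extChartAt_target p
  have hcs : ContMDiffOn 𝓘(ℝ, E) 𝓘(ℝ, E) ∞ c.symm c.target := contMDiffOn_extChartAt_symm p
  have hcc : ContMDiffOn 𝓘(ℝ, E) 𝓘(ℝ, E) ∞ c c.source := by
    simpa [c] using contMDiffOn_extChartAt (I := 𝓘(ℝ, E)) (n := ∞) (x := p)
  have hcso : IsOpen c.source := isOpen_extChartAt_source p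
  have hh : ContDiffOn ℝ ∞ h c.target := (hf.comp_contMDiffOn hcs).contDiffOn
  let L : E →L[ℝ] ℝ := fderiv ℝ h a
  obtain ⟨v, hv⟩ : ∃ v, L v = 1 := by
    suffices hL : mfderiv 𝓘(ℝ, E) 𝓘(ℝ, ℝ) h a ≠ 0 by
      obtain ⟨v, hv⟩ := exists_mfderiv_eq_one hL
      rw [mfderiv_eq_fderiv] at hv
      exact ⟨v, hv⟩
    intro h0
    refine hd p ?_
    have hfc : f =ᶠ[𝓝 p] h ∘ c := by
      filter_upwards [extChartAt_source_mem_nhds (I := 𝓘(ℝ, E)) p] with q hq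
      simp [h, c.left_inv hq]
    have hc : MDifferentiableAt 𝓘(ℝ, E) 𝓘(ℝ, E) c p :=
      mdifferentiableAt_extChartAt (mem_chart_source E p)
    have hha : MDifferentiableAt 𝓘(ℝ, E) 𝓘(ℝ, ℝ) h a :=
      ((hh.contDiffAt (hct.mem_nhds hat)).differentiableAt (by simp)).mdifferentiableAt
    have hcomp := hfc.mfderiv_eq.trans (mfderiv_comp p hha hc)
    ext u
    exact (DFunLike.congr_fun hcomp u).trans (DFunLike.congr_fun h0 _)
  have hL : L.toLinearMap ≠ 0 := fun h0 => one_ne_zero (hv.symm.trans (LinearMap.congr_fun h0 v))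
  have hk := finrank_ker_add_one hL
  -- A straightening map: since `L v = 1`, the function `h` becomes the linear functional `L` after
  -- `G`, and the derivative of `G` at `a` is the identity.
  let G : E → E := fun x => x + (h x - L x) • v
  have hG : ContDiffOn ℝ ∞ G c.target :=
    contDiffOn_id.add ((hh.sub L.contDiff.contDiffOn).smul contDiffOn_const)
  have hLG : ∀ x, L (G x) = h x := fun x => by simp [G, hv]
  have hGa : HasFDerivAt G ((ContinuousLinearEquiv.refl ℝ E : E ≃L[ℝ] E) : E →L[ℝ] E) a := by
    have h1 : HasFDerivAt h L a :=
      ((hh.contDiffAt (hct.mem_nhds hat)).differentiableAt (by simp)).hasFDerivAt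
    convert (hasFDerivAt_id a).add ((h1.sub L.hasFDerivAt).smul_const v) using 1
    · rfl
    · ext x
      simp
  let e := (hG.contDiffAt (hct.mem_nhds hat)).toOpenPartialHomeomorph G hGa (by simp)
  have hea : a ∈ e.source :=
    (hG.contDiffAt (hct.mem_nhds hat)).mem_toOpenPartialHomeomorph_source hGa (by simp)
  -- The local inverse of `G` is known to be smooth only at images of points where `G` is smooth
  -- with invertible derivative. `W` is an open set of such points, and the ball is shrunk until its
  -- image under `ψ` lies in `W`.
  let W : Set E := c.target ∩ fderiv ℝ G ⁻¹' Set.range ((↑) : (E ≃L[ℝ] E) → E →L[ℝ] E)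
  have hW : IsOpen W := (hG.continuousOn_fderiv_of_isOpen hct (by simp)).isOpen_inter_preimage hct
    ContinuousLinearEquiv.isOpen
  have haW : a ∈ W := ⟨hat, ContinuousLinearEquiv.refl ℝ E, hGa.fderiv.symm⟩
  have hA0 : Module.finrank ℝ (EuclideanSpace ℝ (Fin (Module.finrank ℝ (LinearMap.ker L.toLinearMap))))
      = Module.finrank ℝ (LinearMap.ker L.toLinearMap) := by simp
  let A0 := ContinuousLinearEquiv.ofFinrankEq hA0
  let A := (LinearMap.ker L.toLinearMap).subtypeL.comp A0.toContinuousLinearMap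
  have hAi : Function.Injective A := Subtype.val_injective.comp A0.injective
  have hLA : ∀ u, L (A u) = 0 := fun u => (A0 u).2
  let B := fun u => e a + A u
  have hB : Continuous B := continuous_const.add A.continuous
  have hT : IsOpen (B ⁻¹' (e.target ∩ e.symm ⁻¹' W)) :=
    (e.isOpen_inter_preimage_symm hW).preimage hB
  have h0T : (0 : EuclideanSpace ℝ (Fin (Module.finrank ℝ (LinearMap.ker L.toLinearMap)))) ∈
      B ⁻¹' (e.target ∩ e.symm ⁻¹' W) := by
    have hB0 : B 0 = e a := by simp [B]
    refine ⟨?_, ?_⟩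
    · rw [hB0]
      exact e.map_source hea
    · rw [Set.mem_preimage, hB0, e.left_inv hea]
      exact haW
  obtain ⟨r, hr, hball⟩ := Metric.isOpen_iff.1 hT 0 h0T
  let ψ := fun u => e.symm (B u)
  have hψt : ∀ u ∈ Metric.ball 0 r, ψ u ∈ c.target := fun u hu => (hball hu).2.1
  have hGψ : ∀ u ∈ Metric.ball 0 r, G (ψ u) = B u := fun u hu => e.right_inv (hball hu).1
  have hψ : ContDiffOn ℝ ∞ ψ (Metric.ball 0 r) := by
    intro u hu
    obtain ⟨hu1, hu2, D, hD⟩ := hball hu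
    have h1 : ContDiffAt ℝ ∞ G (e.symm (B u)) := hG.contDiffAt (hct.mem_nhds hu2)
    have h2 : HasFDerivAt G (D : E →L[ℝ] E) (e.symm (B u)) := by
      rw [hD]
      exact (h1.differentiableAt (by simp)).hasFDerivAt
    have h3 : ContDiffAt ℝ ∞ e.symm (B u) := e.contDiffAt_symm hu1 h2 h1
    exact (h3.comp u (contDiff_const.add A.contDiff).contDiffAt).contDiffWithinAt
  have hφ : ContMDiffOn 𝓘(ℝ, EuclideanSpace ℝ (Fin _)) 𝓘(ℝ, E) ∞ (c.symm ∘ ψ)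
      (Metric.ball 0 r) := hcs.comp hψ.contMDiffOn hψt
  -- Composing with `G ∘ c` returns the injective affine map `B`; this yields injectivity both of
  -- the parametrization and of its differential.
  have hcφ : ∀ u ∈ Metric.ball 0 r, G (c ((c.symm ∘ ψ) u)) = B u := fun u hu => by
    rw [Function.comp_apply, c.right_inv (hψt u hu), hGψ u hu]
  refine ⟨_, r, c.symm ∘ ψ, hr, ?_, hφ, fun u hu u' hu' huu => ?_, fun u hu => ?_⟩
  · change c.symm (e.symm (e a + A 0)) = p
    rw [map_zero, add_zero, e.left_inv hea]
    exact extChartAt_to_inv p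
  · have h1 := (hcφ u hu).symm.trans ((congrArg (fun x => G (c x)) huu).trans (hcφ u' hu'))
    exact hAi (add_left_cancel h1)
  · have hbu : Metric.ball 0 r ∈ 𝓝 u := Metric.isOpen_ball.mem_nhds hu
    have hφu := (hφ.contMDiffAt hbu).mdifferentiableAt (by simp)
    let D : EuclideanSpace ℝ (Fin (Module.finrank ℝ (LinearMap.ker L.toLinearMap))) →L[ℝ] E :=
      mfderiv 𝓘(ℝ, EuclideanSpace ℝ (Fin _)) 𝓘(ℝ, E) (c.symm ∘ ψ) u
    have hDi : Function.Injective D := by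
      have hGc : MDifferentiableAt 𝓘(ℝ, E) 𝓘(ℝ, E) (G ∘ c) ((c.symm ∘ ψ) u) := by
        have hs : (c.symm ∘ ψ) u ∈ c.source := c.map_target (hψt u hu)
        have h1 := ((hG.contMDiffOn.comp hcc c.mapsTo).contMDiffAt (hcso.mem_nhds hs))
        exact h1.mdifferentiableAt (by simp)
      have h1 := mfderiv_comp u hGc hφu
      have h2 : (G ∘ c) ∘ (c.symm ∘ ψ) =ᶠ[𝓝 u] B := by
        filter_upwards [hbu] with x hx using hcφ x hx
      have h3 : HasFDerivAt B A u := A.hasFDerivAt.const_add _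
      rw [h2.mfderiv_eq, mfderiv_eq_fderiv, h3.fderiv] at h1
      intro x y hxy
      refine hAi ?_
      rw [h1]
      exact congrArg (mfderiv 𝓘(ℝ, E) 𝓘(ℝ, E) (G ∘ c) ((c.symm ∘ ψ) u)) hxy
    refine ⟨hDi, ?_⟩
    let D' : E →L[ℝ] ℝ := mfderiv 𝓘(ℝ, E) 𝓘(ℝ, ℝ) f ((c.symm ∘ ψ) u)
    -- The function `f` is constant along the disc, as `h ∘ ψ = L ∘ B` and `L` vanishes on the range
    -- of `A`. This puts the tangent space in the kernel, and equality follows by counting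
    -- dimensions.
    have hDD : D'.comp D = 0 := by
      have h1 := mfderiv_comp u (hf.mdifferentiable (by simp) _) hφu
      have h2 : f ∘ (c.symm ∘ ψ) =ᶠ[𝓝 u] fun _ => L (e a) := by
        filter_upwards [hbu] with x hx
        change h (ψ x) = L (e a)
        rw [← hLG, hGψ x hx, map_add, hLA, add_zero]
      rw [h2.mfderiv_eq, mfderiv_const] at h1
      exact h1.symm
    refine Submodule.eq_of_le_of_finrank_eq (K := ℝ) (V := E) (S₁ := LinearMap.range D.toLinearMap)
      (S₂ := LinearMap.ker D'.toLinearMap) ?_ ?_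
    · rintro _ ⟨x, rfl⟩
      exact DFunLike.congr_fun hDD x
    · rw [LinearMap.finrank_range_of_inj hDi, hA0]
      exact Nat.add_right_cancel (hk.trans (finrank_dker (E := E) (hd _)).symm)

end Kernel

/-! ### Linear algebra and smooth fields along the graph -/

section Monge

variable {E : Type*} [NormedAddCommGroup E] [NormedSpace ℝ E]
  {M : Type*} [TopologicalSpace M] [ChartedSpace E M]

open Hypersurface

lemma d0_eq (x : ℝ × M) : d0 (E := E) x = ((1 : ℝ), (0 : E)) := by
  rw [d0, mfderiv_prod_left]
  rfl

lemma lift_eq (X : ∀ p : M, TangentSpace 𝓘(ℝ, E) p) (x : ℝ × M) :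
    lift X x = ((0 : ℝ), (X x.2 : E)) := by
  rw [lift, mfderiv_prod_right]
  rfl

section Differentials

variable (F : C^∞⟮𝓘(ℝ, E), M; 𝓘(ℝ, ℝ), ℝ⟯)

/-- The height function of the hypersurface. -/
def height (p : Hypersurface F) : ℝ := F (homeo F p)

lemma contMDiff_height : ContMDiff 𝓘(ℝ, E) 𝓘(ℝ, ℝ) ∞ (height F) :=
  F.contMDiff.comp (contMDiff_homeo F)

/-- The differential of the height function, on the model space. -/
def dheight (p : Hypersurface F) : E →L[ℝ] ℝ := mfderiv 𝓘(ℝ, E) 𝓘(ℝ, ℝ) (height F) p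

/-- The differential of the projection to `M`, on the model space. -/
def dhomeo (p : Hypersurface F) : E →L[ℝ] E := mfderiv 𝓘(ℝ, E) 𝓘(ℝ, E) (homeo F) p

/-- The differential of the inclusion, on the model spaces. -/
def dincl (p : Hypersurface F) : E →L[ℝ] ℝ × E :=
  mfderiv 𝓘(ℝ, E) (𝓘(ℝ, ℝ).prod 𝓘(ℝ, E)) (incl F) p

lemma dincl_apply (p : Hypersurface F) (u : E) : dincl F p u = (dheight F p u, dhomeo F p u) := by
  have h : incl F = fun p => (height F p, homeo F p) := funext fun p => Prod.ext p.2 rfl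
  rw [dincl, h, mfderiv_prodMk ((contMDiff_height F).mdifferentiable (by simp) p)
    ((contMDiff_homeo F).mdifferentiable (by simp) p)]
  rfl

lemma injective_dincl (p : Hypersurface F) : Function.Injective (dincl F p) :=
  injective_mfderiv_incl F p

lemma dheight_apply (p : Hypersurface F) (u : E) :
    dheight F p u = (mfderiv 𝓘(ℝ, E) 𝓘(ℝ, ℝ) F (homeo F p) : E →L[ℝ] ℝ) (dhomeo F p u) := by
  have h := mfderiv_comp p (F.contMDiff.mdifferentiable (by simp) (homeo F p))
    ((contMDiff_homeo F).mdifferentiable (by simp) p)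
  exact DFunLike.congr_fun h u

lemma surjective_dhomeo (p : Hypersurface F) : Function.Surjective (dhomeo F p) := by
  obtain ⟨p, rfl⟩ := (homeo F).symm.surjective p
  intro v
  have h := mfderiv_comp p ((contMDiff_homeo F).mdifferentiable (by simp)
    ((homeo F).symm p)) ((contMDiff_homeo_symm F).mdifferentiable (by simp) p)
  have hc : homeo F ∘ (homeo F).symm = id := funext (homeo F).apply_symm_apply
  rw [hc, mfderiv_id] at h
  exact ⟨_, (DFunLike.congr_fun h v).symm⟩

/-- The coordinate field `∂₀` is smooth along the hypersurface. -/
lemma isSmoothFieldOn_d0 [IsManifold 𝓘(ℝ, E) ∞ M] :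
    IsSmoothFieldOn 𝓘(ℝ, E) (𝓘(ℝ, ℝ).prod 𝓘(ℝ, E)) (incl F) (fun p => d0 (incl F p))
      Set.univ := by
  have h1 : ContMDiff 𝓘(ℝ, ℝ) 𝓘(ℝ, ℝ).tangent ∞
      (fun t => (⟨t, (1 : ℝ)⟩ : TangentBundle 𝓘(ℝ, ℝ) ℝ)) := fun t =>
    contMDiffAt_vectorSpace_iff_contDiffAt.2 contDiffAt_const
  have h2 : ContMDiff 𝓘(ℝ, E) 𝓘(ℝ, E).tangent ∞
      (fun x : M => (⟨x, (0 : E)⟩ : TangentBundle 𝓘(ℝ, E) M)) :=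
    Bundle.contMDiff_zeroSection ℝ (TangentSpace 𝓘(ℝ, E) : M → Type _)
  have h3 := (contMDiff_equivTangentBundleProd_symm (n := ∞) (I := 𝓘(ℝ, ℝ)) (M := ℝ)
    (I' := 𝓘(ℝ, E)) (M' := M)).comp
    ((h1.comp (contMDiff_height F)).prodMk (h2.comp (contMDiff_homeo F)))
  refine (h3.congr fun p => ?_).contMDiffOn
  have h4 : ∀ x : ℝ × M, (⟨x, d0 x⟩ : TangentBundle (𝓘(ℝ, ℝ).prod 𝓘(ℝ, E)) (ℝ × M)) =
      ⟨x, ((1 : ℝ), (0 : E))⟩ := fun x => by rw [d0_eq]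
  have h5 : incl F p = (height F p, homeo F p) := Prod.ext p.2 rfl
  exact (h4 _).trans (congrArg (fun x : ℝ × M =>
    (⟨x, ((1 : ℝ), (0 : E))⟩ : TangentBundle (𝓘(ℝ, ℝ).prod 𝓘(ℝ, E)) (ℝ × M))) h5)

end Differentials

section Form

variable [IsManifold 𝓘(ℝ, E) ∞ M]
  (g : SemiRiemannianMetric 𝓘(ℝ, E) M) (F : C^∞⟮𝓘(ℝ, E), M; 𝓘(ℝ, ℝ), ℝ⟯)

lemma ambientMetric_form_apply (x : ℝ × M) (u v : ℝ × E) :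
    (ambientMetric g).form x u v = -(u.1 * v.1) + g.form x.2 u.2 v.2 :=
  ambientForm_apply _ _ _ _

/-- The metric of `M` at the foot point of `p`, on the model space. -/
def formAt (p : Hypersurface F) : E →L[ℝ] E →L[ℝ] ℝ := g.form (homeo F p)

variable {g F}

lemma formAt_symm {p : Hypersurface F} (u v : E) : formAt g F p u v = formAt g F p v u :=
  g.symm _ _ _

lemma form_incl {p : Hypersurface F} (u v : ℝ × E) :
    (ambientMetric g).form (incl F p) u v = -(u.1 * v.1) + formAt g F p u.2 v.2 :=
  ambientForm_apply _ _ _ _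

end Form

variable [IsManifold 𝓘(ℝ, E) ∞ M] [FiniteDimensional ℝ E]
  (g : SemiRiemannianMetric 𝓘(ℝ, E) M) (F : C^∞⟮𝓘(ℝ, E), M; 𝓘(ℝ, ℝ), ℝ⟯)

lemma xi_eq (x : ℝ × M) : xi g F x = ((1 : ℝ), (g.grad F x.2 : E)) := by
  rw [xi, d0_eq, lift_eq]
  exact Prod.ext (add_zero (1 : ℝ)) (zero_add (g.grad F x.2 : E))

lemma transversalField_eq (x : ℝ × M) :
    transversalField g F x = ((-(1 / 2) : ℝ), ((1 / 2 : ℝ) • g.grad F x.2 : E)) := by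
  rw [transversalField, d0_eq, lift_eq]
  have h : ∀ v : E, (-(1 / 2) : ℝ) • (((1 : ℝ), (0 : E)) - ((0 : ℝ), v)) =
      ((-(1 / 2) : ℝ), (1 / 2 : ℝ) • v) := fun v => by simp
  exact h _

/-- The gradient of `F` at the foot point of `p`, as an element of the model space. -/
def gradAt (p : Hypersurface F) : E := g.grad F (homeo F p)

variable {g F}
variable {p : Hypersurface F}

/-- Nondegeneracy of `g` in the form used to show that a vector lies on the gradient line. -/
lemma eq_smul_gradAt {a : ℝ} {w : E}
    (h : ∀ v, formAt g F p w v = a * formAt g F p (gradAt g F p) v) : w = a • gradAt g F p := by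
  have h' : ∀ v : E, formAt g F p (w - a • gradAt g F p) v = 0 := fun v => by simp [h v]
  exact sub_eq_zero.1 (g.nondegenerate (homeo F p) _ h')

lemma xi_incl : xi g F (incl F p) = ((1 : ℝ), gradAt g F p) := xi_eq g F _

lemma transversalField_incl :
    transversalField g F (incl F p) = ((-(1 / 2) : ℝ), (1 / 2 : ℝ) • gradAt g F p) :=
  transversalField_eq g F _

lemma dheight_eq (u : E) :
    dheight F p u = formAt g F p (gradAt g F p) (dhomeo F p u) :=
  (dheight_apply F p u).trans (g.grad_spec F (homeo F p) (dhomeo F p u)).symm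

lemma mem_tangent_incl (u : ℝ × E) :
    u ∈ tangent 𝓘(ℝ, E) (𝓘(ℝ, ℝ).prod 𝓘(ℝ, E)) (incl F) p ↔
      u.1 = formAt g F p (gradAt g F p) u.2 := by
  constructor
  · rintro ⟨(v : E), hv⟩
    obtain rfl : _ = u := (dincl_apply F p v).symm.trans hv
    exact dheight_eq v
  · intro h
    obtain ⟨v, hv⟩ := surjective_dhomeo F p u.2
    refine ⟨v, (dincl_apply F p v).trans (Prod.ext ?_ hv)⟩
    exact (dheight_eq (g := g) v).trans ((congrArg _ hv).trans h.symm)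

/-- Testing against the tangent vectors `(g(n, v), v)` gives `g(u.2, v) = u.1 * g(n, v)` for all
`v`. So the normal space is the line of `ξ`, whether or not the hypersurface is lightlike. -/
lemma mem_normal_incl (u : ℝ × E) :
    u ∈ normal 𝓘(ℝ, E) (𝓘(ℝ, ℝ).prod 𝓘(ℝ, E)) (ambientMetric g).form (incl F) p ↔
      u.2 = u.1 • gradAt g F p := by
  constructor
  · intro h
    refine eq_smul_gradAt fun v => ?_
    have h1 := h ((formAt g F p (gradAt g F p) v, v) : ℝ × E) ((mem_tangent_incl _).2 rfl)
    rw [form_incl] at h1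
    exact (neg_add_eq_zero.1 h1).symm
  · intro h v hv
    refine (form_incl u v).trans ?_
    rw [(mem_tangent_incl (g := g) v).1 hv, h]
    simp

/-- Orthogonality to `∂₀` removes the time component; orthogonality to `ξ` then concerns `n` alone.
-/
lemma mem_canonicalScreen (u : ℝ × E) :
    u ∈ canonicalScreen g F p ↔ u.1 = 0 ∧ formAt g F p (gradAt g F p) u.2 = 0 := by
  have h1 : (ambientMetric g).form (incl F p) u (xi g F (incl F p)) =
      -u.1 + formAt g F p (gradAt g F p) u.2 := by
    rw [xi_incl]
    refine (form_incl u ((1 : ℝ), gradAt g F p)).trans ?_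
    rw [formAt_symm, mul_one]
  have h2 : (ambientMetric g).form (incl F p) u (d0 (incl F p)) = -u.1 := by
    rw [d0_eq]
    refine (form_incl u ((1 : ℝ), (0 : E))).trans ?_
    simp
  constructor
  · intro h
    have h3 := h1.symm.trans (h _ (Submodule.subset_span (Set.mem_insert _ _)))
    have h4 := h2.symm.trans (h _ (Submodule.subset_span (Set.mem_insert_of_mem _ rfl)))
    constructor <;> linarith
  · rintro ⟨h3, h4⟩ v hv
    obtain ⟨a, b, rfl⟩ := Submodule.mem_span_pair.1 hv
    rw [map_add, map_smul, map_smul, h1, h2, h3, h4]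
    simp

lemma canonicalScreen_le_tangent :
    canonicalScreen g F p ≤ tangent 𝓘(ℝ, E) (𝓘(ℝ, ℝ).prod 𝓘(ℝ, E)) (incl F) p := by
  intro (u : ℝ × E) hu
  have h := (mem_canonicalScreen u).1 hu
  exact (mem_tangent_incl (g := g) u).2 (h.1.trans h.2.symm)

-- The time component of a pushed-forward vector is its height derivative, which also equals `g(n,
-- ·)` of its other component. Hence the two conditions defining the screen coincide on tangent
-- vectors.
variable (g F) in
lemma asDistribution_canonicalScreen :
    asDistribution 𝓘(ℝ, E) (𝓘(ℝ, ℝ).prod 𝓘(ℝ, E)) (incl F) (canonicalScreen g F) =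
      dker (E := E) (height F) := by
  ext p u
  have h : ∀ u : E, dincl F p u ∈ canonicalScreen g F p ↔ dheight F p u = 0 := fun u => by
    refine (mem_canonicalScreen _).trans ?_
    rw [dincl_apply]
    exact ⟨fun h => h.1, fun h => ⟨h, (dheight_eq (g := g) u).symm.trans h⟩⟩
  exact h u

lemma canonicalScreen_eq_map : canonicalScreen g F p = (dker (E := E) (height F) p).map
    (mfderiv 𝓘(ℝ, E) (𝓘(ℝ, ℝ).prod 𝓘(ℝ, E)) (incl F) p).toLinearMap := by
  rw [← asDistribution_canonicalScreen g, asDistribution, Submodule.map_comap_eq]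
  exact (inf_eq_right.2 canonicalScreen_le_tangent).symm

lemma dincl_of_mem_radical {u : E}
    (hu : u ∈ radical 𝓘(ℝ, E) (pullback 𝓘(ℝ, E) (𝓘(ℝ, ℝ).prod 𝓘(ℝ, E))
      (ambientMetric g).form (incl F)) p) :
    dincl F p u = dheight F p u • ((1 : ℝ), gradAt g F p) := by
  have hn : dincl F p u ∈
      normal 𝓘(ℝ, E) (𝓘(ℝ, ℝ).prod 𝓘(ℝ, E)) (ambientMetric g).form (incl F) p := by
    rintro _ ⟨v, rfl⟩
    exact hu v trivial
  rw [dincl_apply] at hn ⊢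
  exact Prod.ext (mul_one _).symm ((mem_normal_incl _).1 hn)

/-- A radical vector is pushed forward to `dheight F p u` times `ξ`, and the inclusion is an
immersion. This allows division by the height derivative. -/
lemma dheight_ne_zero_of_mem_radical {u : E}
    (hu : u ∈ radical 𝓘(ℝ, E) (pullback 𝓘(ℝ, E) (𝓘(ℝ, ℝ).prod 𝓘(ℝ, E))
      (ambientMetric g).form (incl F)) p) (hu0 : u ≠ 0) : dheight F p u ≠ 0 := by
  intro h
  refine hu0 (injective_dincl F p ?_)
  rw [dincl_of_mem_radical hu, h, zero_smul, map_zero]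

/-- The lightlike Monge hypersurfaces are given by functions with unit spacelike gradient. -/
lemma formAt_gradAt_self (hF : IsLightlikeSubmanifold 𝓘(ℝ, E) (𝓘(ℝ, ℝ).prod 𝓘(ℝ, E))
    (ambientMetric g).form (incl F)) (p : Hypersurface F) :
    formAt g F p (gradAt g F p) (gradAt g F p) = 1 := by
  obtain ⟨⟨r, hr, hrank⟩, -⟩ := hF
  have hb : radical 𝓘(ℝ, E) (pullback 𝓘(ℝ, E) (𝓘(ℝ, ℝ).prod 𝓘(ℝ, E))
      (ambientMetric g).form (incl F)) p ≠ ⊥ := by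
    intro h
    have := hrank p
    rw [h, finrank_bot] at this
    omega
  obtain ⟨(u : E), hu, hu0⟩ := Submodule.exists_mem_ne_zero_of_ne_bot hb
  have ha := dheight_ne_zero_of_mem_radical (E := E) hu hu0
  have h1 := (dincl_apply F p u).symm.trans (dincl_of_mem_radical (E := E) hu)
  have h2 : dhomeo F p u = dheight F p u • gradAt g F p := congrArg Prod.snd h1
  have h3 := dheight_eq (g := g) (p := p) u
  rw [h2, map_smul, smul_eq_mul] at h3
  -- With `a` the height derivative of `u`, tangency of `a ξ` reads `a = a * g(n, n)`; cancel `a`.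
  exact mul_left_cancel₀ ha (h3.symm.trans (mul_one _).symm)

/-- The tangent vector lying over `n` has height derivative `g(n, n) = 1`. -/
lemma mfderiv_height_ne_zero (hF : IsLightlikeSubmanifold 𝓘(ℝ, E) (𝓘(ℝ, ℝ).prod 𝓘(ℝ, E))
    (ambientMetric g).form (incl F)) (p : Hypersurface F) :
    mfderiv 𝓘(ℝ, E) 𝓘(ℝ, ℝ) (height F) p ≠ 0 := by
  intro h
  obtain ⟨u, hu⟩ := surjective_dhomeo F p (gradAt g F p)
  have h1 := dheight_eq (g := g) (p := p) u
  rw [hu, formAt_gradAt_self hF] at h1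
  exact one_ne_zero (α := ℝ) (h1.symm.trans (DFunLike.congr_fun h u))

/-- The field `ξ` is smooth along a lightlike Monge hypersurface. -/
lemma isSmoothFieldOn_xi (hF : IsLightlikeSubmanifold 𝓘(ℝ, E) (𝓘(ℝ, ℝ).prod 𝓘(ℝ, E))
    (ambientMetric g).form (incl F)) :
    IsSmoothFieldOn 𝓘(ℝ, E) (𝓘(ℝ, ℝ).prod 𝓘(ℝ, E)) (incl F) (fun p => xi g F (incl F p))
      Set.univ := by
  obtain ⟨⟨r, hr, hrank⟩, hsm⟩ := hF
  intro p _
  obtain ⟨U, hU, hpU, k, X, hX, hXr⟩ := hsm p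
  have hk : k = r := by
    rw [← hrank p, ← (hXr p hpU).2, finrank_span_eq_card (hXr p hpU).1, Fintype.card_fin]
  -- Positivity of the rank supplies a frame field of the radical. Its pushforward divided by its
  -- height derivative is `ξ`, so `ξ` is smooth without a separate proof that the gradient is.
  let i : Fin k := ⟨0, hk ▸ hr⟩
  have hrad : ∀ q ∈ U, X i q ∈ radical 𝓘(ℝ, E) (pullback 𝓘(ℝ, E) (𝓘(ℝ, ℝ).prod 𝓘(ℝ, E))
      (ambientMetric g).form (incl F)) q := fun q hq => by
    rw [← (hXr q hq).2]
    exact Submodule.subset_span ⟨i, rfl⟩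
  have hne : ∀ q ∈ U, (mfderiv 𝓘(ℝ, E) 𝓘(ℝ, ℝ) (height F) q (X i q) : ℝ) ≠ 0 := fun q hq =>
    dheight_ne_zero_of_mem_radical (E := E) (hrad q hq) ((hXr q hq).1.ne_zero i)
  have ha := (hX i).contMDiffOn_mfderiv_apply (contMDiff_height F)
  have h : IsSmoothFieldOn 𝓘(ℝ, E) (𝓘(ℝ, ℝ).prod 𝓘(ℝ, E)) (incl F)
      (fun p => xi g F (incl F p)) U := by
    refine (((hX i).mfderiv_apply (contMDiff_incl F)).smul (ha.inv₀ hne)).congr fun q hq => ?_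
    let u : E := X i q
    have h1 : ((1 : ℝ), gradAt g F q) = (dheight F q u)⁻¹ • dincl F q u := by
      rw [dincl_of_mem_radical (E := E) (hrad q hq), smul_smul, inv_mul_cancel₀ (hne q hq), one_smul]
    exact xi_incl.trans h1
  exact (ContMDiffOn.contMDiffAt h (hU.mem_nhds hpU)).contMDiffWithinAt

lemma isSmoothFieldOn_transversalField (hF : IsLightlikeSubmanifold 𝓘(ℝ, E)
    (𝓘(ℝ, ℝ).prod 𝓘(ℝ, E)) (ambientMetric g).form (incl F)) :
    IsSmoothFieldOn 𝓘(ℝ, E) (𝓘(ℝ, ℝ).prod 𝓘(ℝ, E)) (incl F)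
      (fun p => transversalField g F (incl F p)) Set.univ := by
  refine (IsSmoothFieldOn.smul_add_smul (contMDiffOn_const (c := (1 / 2 : ℝ)))
    (isSmoothFieldOn_xi hF) (contMDiffOn_const (c := (-1 : ℝ))) (isSmoothFieldOn_d0 F)).congr
    fun p _ => ?_
  rw [transversalField, xi]
  module

end Monge

/-! ### Screen and transversal bundle of a lightlike graph -/

section LightlikeMonge

open Hypersurface

variable {E : Type*} [NormedAddCommGroup E] [NormedSpace ℝ E] [FiniteDimensional ℝ E]
  {M : Type*} [TopologicalSpace M] [ChartedSpace E M] [IsManifold 𝓘(ℝ, E) ∞ M]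
  {g : SemiRiemannianMetric 𝓘(ℝ, E) M} {F : C^∞⟮𝓘(ℝ, E), M; 𝓘(ℝ, ℝ), ℝ⟯}

/-- The canonical screen of a lightlike Monge hypersurface is a screen distribution. -/
lemma isScreenDistribution_canonicalScreen (hF : IsLightlikeSubmanifold 𝓘(ℝ, E)
    (𝓘(ℝ, ℝ).prod 𝓘(ℝ, E)) (ambientMetric g).form (incl F)) :
    IsScreenDistribution 𝓘(ℝ, E) (𝓘(ℝ, ℝ).prod 𝓘(ℝ, E)) (ambientMetric g).form
      (incl F) (canonicalScreen g F) := by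
  refine ⟨fun p => ?_, fun p => ⟨le_antisymm (sup_le canonicalScreen_le_tangent ?_) ?_, ?_⟩⟩
  · obtain ⟨U, hU, hpU, k, X, hX, hXs⟩ :=
      isSmoothSubbundle_dker (contMDiff_height F) (mfderiv_height_ne_zero hF) p
    refine ⟨U, hU, hpU, k, fun i q => mfderiv 𝓘(ℝ, E) (𝓘(ℝ, ℝ).prod 𝓘(ℝ, E)) (incl F) q (X i q),
      fun i => (hX i).mfderiv_apply (contMDiff_incl F), fun q hq => ⟨?_, ?_⟩⟩
    · exact (hXs q hq).1.map' _ (LinearMap.ker_eq_bot.2 (injective_mfderiv_incl F q))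
    · rw [canonicalScreen_eq_map, ← (hXs q hq).2, Submodule.map_span, ← Set.range_comp]
      rfl
  · intro (u : ℝ × E) hu
    refine (mem_tangent_incl (g := g) u).2 ?_
    rw [(mem_normal_incl u).1 hu, map_smul, formAt_gradAt_self hF, smul_eq_mul, mul_one]
  · intro (u : ℝ × E) hu
    have h1 := (mem_tangent_incl (g := g) u).1 hu
    -- Split off `u.1 • ξ`; the remainder is in the screen because `g(n, u.2) = u.1` and `g(n, n) =
    -- 1`.
    refine Submodule.mem_sup.2 ⟨((0 : ℝ), u.2 - u.1 • gradAt g F p), ?_,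
      (u.1, u.1 • gradAt g F p), (mem_normal_incl _).2 rfl, ?_⟩
    · refine (mem_canonicalScreen _).2 ⟨rfl, ?_⟩
      simp [formAt_gradAt_self hF, h1]
    · exact Prod.ext (zero_add u.1) (sub_add_cancel u.2 (u.1 • gradAt g F p))
  · refine Submodule.disjoint_def.2 fun (u : ℝ × E) hu hu' => ?_
    have h1 := ((mem_canonicalScreen u).1 hu).1
    have h2 := (mem_normal_incl u).1 hu'
    exact Prod.ext h1 (by rw [h2, h1, zero_smul]; rfl)

lemma xi_mem_normal {p : Hypersurface F} : xi g F (incl F p) ∈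
    normal 𝓘(ℝ, E) (𝓘(ℝ, ℝ).prod 𝓘(ℝ, E)) (ambientMetric g).form (incl F) p := by
  rw [xi_incl]
  exact (mem_normal_incl _).2 (one_smul ℝ _).symm

lemma xi_ne_zero {p : Hypersurface F} : xi g F (incl F p) ≠ 0 := by
  rw [xi_incl]
  exact fun h => one_ne_zero (α := ℝ) (congrArg (fun v : ℝ × E => v.1) h)

/-- Neither the fields nor the metric depend on the time coordinate, so the identity `g(n, n) = 1`
at the point of the graph over `x.2` suffices on all of `ℝ × M`. -/
lemma form_xi_transversalField (hF : IsLightlikeSubmanifold 𝓘(ℝ, E)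
    (𝓘(ℝ, ℝ).prod 𝓘(ℝ, E)) (ambientMetric g).form (incl F)) (x : ℝ × M) :
    (ambientMetric g).form x (xi g F x) (transversalField g F x) = 1 := by
  rw [xi_eq, transversalField_eq]
  let B : E →L[ℝ] E →L[ℝ] ℝ := g.form x.2
  let n : E := g.grad F x.2
  have hn : B n n = 1 := formAt_gradAt_self hF ((homeo F).symm x.2)
  refine (ambientMetric_form_apply g x ((1 : ℝ), n) ((-(1 / 2) : ℝ), (1 / 2 : ℝ) • n)).trans ?_
  change -((1 : ℝ) * -(1 / 2)) + B n ((1 / 2 : ℝ) • n) = 1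
  rw [map_smul, hn]
  norm_num

/-- `N_ξ` is a transversal field on a lightlike Monge hypersurface. -/
lemma isTransversalFieldOn_transversalField (hF : IsLightlikeSubmanifold 𝓘(ℝ, E)
    (𝓘(ℝ, ℝ).prod 𝓘(ℝ, E)) (ambientMetric g).form (incl F)) :
    IsTransversalFieldOn 𝓘(ℝ, E) (𝓘(ℝ, ℝ).prod 𝓘(ℝ, E)) (ambientMetric g).form
      (incl F) (canonicalScreen g F) (fun p => xi g F (incl F p))
      (fun p => transversalField g F (incl F p)) Set.univ := by
  refine ⟨isSmoothFieldOn_transversalField hF, fun p _ => ⟨?_, form_xi_transversalField hF (incl F p), ?_, ?_⟩⟩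
  · intro h
    have h1 := form_xi_transversalField hF (incl F p)
    replace h : transversalField g F (incl F p) = 0 := h
    rw [h, map_zero] at h1
    exact zero_ne_one h1
  · change (ambientMetric g).form (incl F p) (transversalField g F (incl F p))
      (transversalField g F (incl F p)) = 0
    rw [transversalField_incl]
    refine (form_incl ((-(1 / 2) : ℝ), (1 / 2 : ℝ) • gradAt g F p)
      ((-(1 / 2) : ℝ), (1 / 2 : ℝ) • gradAt g F p)).trans ?_
    simp [formAt_gradAt_self hF]
  · intro (w : ℝ × E) hw
    obtain ⟨h1, h2⟩ := (mem_canonicalScreen w).1 hw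
    change (ambientMetric g).form (incl F p) w (transversalField g F (incl F p)) = 0
    rw [transversalField_incl]
    refine (form_incl w ((-(1 / 2) : ℝ), (1 / 2 : ℝ) • gradAt g F p)).trans ?_
    rw [h1, map_smul, formAt_symm, h2]
    simp

/-- A null vector orthogonal to the canonical screen and normalized against `ξ` is `N_ξ`. -/
lemma eq_transversalField (hF : IsLightlikeSubmanifold 𝓘(ℝ, E)
    (𝓘(ℝ, ℝ).prod 𝓘(ℝ, E)) (ambientMetric g).form (incl F)) {p : Hypersurface F} {u : ℝ × E}
    (h1 : (ambientMetric g).form (incl F p) (xi g F (incl F p)) u = 1)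
    (h0 : (ambientMetric g).form (incl F p) u u = 0)
    (hS : ∀ w ∈ canonicalScreen g F p, (ambientMetric g).form (incl F p) w u = 0) :
    u = transversalField g F (incl F p) := by
  rw [xi_incl] at h1
  replace h1 := (form_incl ((1 : ℝ), gradAt g F p) u).symm.trans h1
  replace h0 := (form_incl u u).symm.trans h0
  set b := formAt g F p (gradAt g F p) u.2 with hb
  have hu : u.2 = b • gradAt g F p := by
    refine eq_smul_gradAt fun v => ?_
    -- Test against the projection of an arbitrary `v` to the orthogonal space of the unit vector
    -- `n`.
    have h2 := hS (((0 : ℝ), v - formAt g F p (gradAt g F p) v • gradAt g F p) : ℝ × E)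
      ((mem_canonicalScreen _).2 ⟨rfl, by simp [formAt_gradAt_self hF]⟩)
    replace h2 := (form_incl ((0 : ℝ), v - formAt g F p (gradAt g F p) v • gradAt g F p) u).symm.trans
      h2
    simp only [zero_mul, neg_zero, zero_add, map_sub, map_smul, sub_apply, smul_apply, smul_eq_mul,
      ← hb] at h2
    rw [formAt_symm]
    linarith
  have hbb : formAt g F p u.2 u.2 = b * b := by
    conv_lhs => rw [hu]
    simp [formAt_gradAt_self hF]
  rw [hbb] at h0
  -- Normalization gives `u.1 = b - 1`, and nullity `u.1² = b²`; the quadratic terms cancel.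
  have h3 : b = 1 / 2 := by
    have h4 : u.1 = b - 1 := by linarith
    rw [h4] at h0
    linarith
  rw [transversalField_incl]
  refine Prod.ext (?_ : u.1 = -(1 / 2)) (hu.trans (by rw [h3]))
  linarith

/-- The line bundle spanned by `N_ξ` is a lightlike transversal bundle. -/
lemma isLightlikeTransversalBundle_transversalLine (hF : IsLightlikeSubmanifold 𝓘(ℝ, E)
    (𝓘(ℝ, ℝ).prod 𝓘(ℝ, E)) (ambientMetric g).form (incl F)) :
    IsLightlikeTransversalBundle 𝓘(ℝ, E) (𝓘(ℝ, ℝ).prod 𝓘(ℝ, E)) (ambientMetric g).form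
      (incl F) (canonicalScreen g F) (transversalLine g F) := by
  obtain ⟨hN, hNp⟩ := isTransversalFieldOn_transversalField hF
  have hN0 : ∀ p, transversalField g F (incl F p) ≠ 0 := fun p => (hNp p trivial).1
  refine ⟨fun p => ⟨Set.univ, isOpen_univ, trivial, 1,
    fun _ q => transversalField g F (incl F q), fun _ => hN, fun q _ => ⟨?_, ?_⟩⟩,
    fun p => finrank_span_singleton (hN0 p), fun p => ⟨?_, ?_⟩, ?_⟩
  · exact linearIndependent_unique_iff.2 (hN0 q)
  · rw [Set.range_const]
    rfl
  · refine Submodule.disjoint_def.2 fun u hu hu' => ?_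
    obtain ⟨a, rfl⟩ := Submodule.mem_span_singleton.1 hu'
    rw [transversalField_incl] at hu
    have h := (mem_tangent_incl (g := g)
      (a • (((-(1 / 2) : ℝ), (1 / 2 : ℝ) • gradAt g F p) : ℝ × E))).1 hu
    simp only [Prod.smul_mk, map_smul, formAt_gradAt_self hF, smul_eq_mul] at h
    have ha : a = 0 := by linarith
    rw [ha, zero_smul]
  · refine codisjoint_iff_le_sup.2 fun (u : ℝ × E) _ => ?_
    -- This is the pairing of `u` with `ξ`. As `ξ` pairs to `1` with `N_ξ`, subtracting `c` times
    -- `N_ξ` lands in the orthogonal space of `ξ`, which is the tangent space.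
    let c : ℝ := -u.1 + formAt g F p (gradAt g F p) u.2
    let n : ℝ × E := ((-(1 / 2) : ℝ), (1 / 2 : ℝ) • gradAt g F p)
    have hn : n = transversalField g F (incl F p) := transversalField_incl.symm
    refine Submodule.mem_sup.2 ⟨u - c • n, (mem_tangent_incl (g := g) _).2 ?_, c • n,
      Submodule.mem_span_singleton.2 ⟨c, by rw [hn]; rfl⟩, sub_add_cancel u (c • n)⟩
    simp only [n, c, Prod.fst_sub, Prod.snd_sub, Prod.smul_mk, map_sub, map_smul,
      formAt_gradAt_self hF, smul_eq_mul]
    ring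
  · intro U η hU hη hηn p hp
    -- The coefficient in `η = c ξ` is the time component of `η`. Writing it as `dx⁰(η)` makes its
    -- smoothness visible; the required section is then `c⁻¹ N_ξ` on all of `U`.
    let c : Hypersurface F → ℝ := fun q => mfderiv (𝓘(ℝ, ℝ).prod 𝓘(ℝ, E)) 𝓘(ℝ, ℝ)
      (Prod.fst : ℝ × M → ℝ) (incl F q) (η q)
    have hc : ContMDiffOn 𝓘(ℝ, E) 𝓘(ℝ, ℝ) ∞ c U :=
      (hη.mfderiv_comp_apply contMDiff_fst).contMDiffOn_of_real
    have hηc : ∀ q ∈ U, η q = c q • xi g F (incl F q) := by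
      intro q hq
      have h1 : c q = (η q : ℝ × E).1 := by
        simp only [c, mfderiv_fst]
        rfl
      rw [xi_incl, h1]
      exact Prod.ext (mul_one _).symm ((mem_normal_incl _).1 (hηn q hq).1)
    have hc0 : ∀ q ∈ U, c q ≠ 0 := fun q hq h => (hηn q hq).2 (by rw [hηc q hq, h, zero_smul])
    refine ⟨U, subset_rfl, hU, hp, fun q => (c q)⁻¹ • transversalField g F (incl F q),
      ⟨⟨(hN.mono (Set.subset_univ U)).smul (hc.inv₀ hc0), fun q hq => ?_⟩, fun q _ =>
        Submodule.smul_mem _ _ (Submodule.mem_span_singleton_self _)⟩, fun X' hX' q hq => ?_⟩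
    · obtain ⟨h0, h1, h2, h3⟩ := hNp q trivial
      refine ⟨smul_ne_zero (inv_ne_zero (hc0 q hq)) h0, ?_, ?_, fun w hw => ?_⟩
      · rw [hηc q hq]
        simp only [map_smul, smul_apply, smul_eq_mul] at h1 ⊢
        rw [h1, mul_one, inv_mul_cancel₀ (hc0 q hq)]
      · simp only [map_smul, smul_apply, smul_eq_mul] at h2 ⊢
        rw [h2, mul_zero, mul_zero]
      · simp only [map_smul, smul_eq_mul]
        exact (congrArg _ (h3 w hw)).trans (mul_zero _)
    · obtain ⟨⟨-, hX⟩, hXN⟩ := hX'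
      obtain ⟨a, ha⟩ := Submodule.mem_span_singleton.1 (hXN q hq)
      have h1 := (hX q hq).2.1
      have h2 := (hNp q trivial).2.1
      rw [hηc q hq, ← ha] at h1
      simp only [map_smul, smul_apply, smul_eq_mul] at h1 h2
      rw [h2, mul_one] at h1
      rw [← ha, eq_inv_of_mul_eq_one_left h1]

/-- A lightlike transversal bundle associated with the canonical screen is spanned by `N_ξ`. -/
lemma IsLightlikeTransversalBundle.eq_transversalLine (hF : IsLightlikeSubmanifold 𝓘(ℝ, E)
    (𝓘(ℝ, ℝ).prod 𝓘(ℝ, E)) (ambientMetric g).form (incl F))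
    {tr : ∀ p : Hypersurface F, Submodule ℝ (TangentSpace (𝓘(ℝ, ℝ).prod 𝓘(ℝ, E)) (incl F p))}
    (htr : IsLightlikeTransversalBundle 𝓘(ℝ, E) (𝓘(ℝ, ℝ).prod 𝓘(ℝ, E)) (ambientMetric g).form
      (incl F) (canonicalScreen g F) tr) : tr = transversalLine g F := by
  obtain ⟨-, hrank, -, h⟩ := htr
  funext p
  -- Applied to the global normal section `ξ`, the defining property yields a vector of `tr p` that
  -- must be `N_ξ`; both spaces are lines, so they agree.
  obtain ⟨U', -, -, hp, X, ⟨⟨-, hX⟩, hXtr⟩, -⟩ := h Set.univ (fun p => xi g F (incl F p)) isOpen_univ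
    (isSmoothFieldOn_xi hF) (fun q _ => ⟨xi_mem_normal, xi_ne_zero⟩) p trivial
  obtain ⟨-, h1, h0, hS⟩ := hX p hp
  have hXN : X p = transversalField g F (incl F p) := eq_transversalField hF h1 h0 hS
  have hN := ((isTransversalFieldOn_transversalField hF).2 p trivial).1
  have : FiniteDimensional ℝ (TangentSpace (𝓘(ℝ, ℝ).prod 𝓘(ℝ, E)) (incl F p)) :=
    inferInstanceAs (FiniteDimensional ℝ (ℝ × E))
  refine (Submodule.eq_of_le_of_finrank_eq ?_ ((finrank_span_singleton hN).trans
    (hrank p).symm)).symm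
  refine (Submodule.span_singleton_le_iff_mem _ _).2 ?_
  have hXp := hXtr p hp
  rwa [hXN] at hXp

end LightlikeMonge

end LightlikeGeometry

open LightlikeGeometry in
theorem mainTheorem3 {E : Type*} [NormedAddCommGroup E] [NormedSpace ℝ E] [FiniteDimensional ℝ E]
    {M : Type*} [TopologicalSpace M] [ChartedSpace E M] [IsManifold 𝓘(ℝ, E) ∞ M]
    (g : SemiRiemannianMetric 𝓘(ℝ, E) M) (F : C^∞⟮𝓘(ℝ, E), M; 𝓘(ℝ, ℝ), ℝ⟯)
    (hF : IsLightlikeSubmanifold 𝓘(ℝ, E) (𝓘(ℝ, ℝ).prod 𝓘(ℝ, E)) (ambientMetric g).form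
      (Hypersurface.incl F)) :
    IsScreenDistribution 𝓘(ℝ, E) (𝓘(ℝ, ℝ).prod 𝓘(ℝ, E)) (ambientMetric g).form
      (Hypersurface.incl F) (canonicalScreen g F) ∧
    IsInvolutive 𝓘(ℝ, E)
      (asDistribution 𝓘(ℝ, E) (𝓘(ℝ, ℝ).prod 𝓘(ℝ, E)) (Hypersurface.incl F)
        (canonicalScreen g F)) ∧
    IsIntegrable 𝓘(ℝ, E)
      (asDistribution 𝓘(ℝ, E) (𝓘(ℝ, ℝ).prod 𝓘(ℝ, E)) (Hypersurface.incl F)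
        (canonicalScreen g F)) ∧
    (∀ tr : ∀ p : Hypersurface F,
        Submodule ℝ (TangentSpace (𝓘(ℝ, ℝ).prod 𝓘(ℝ, E)) (Hypersurface.incl F p)),
      IsLightlikeTransversalBundle 𝓘(ℝ, E) (𝓘(ℝ, ℝ).prod 𝓘(ℝ, E)) (ambientMetric g).form
        (Hypersurface.incl F) (canonicalScreen g F) tr ↔ tr = transversalLine g F) ∧
    IsTransversalFieldOn 𝓘(ℝ, E) (𝓘(ℝ, ℝ).prod 𝓘(ℝ, E)) (ambientMetric g).form
      (Hypersurface.incl F) (canonicalScreen g F) (fun p => xi g F (Hypersurface.incl F p))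
      (fun p => transversalField g F (Hypersurface.incl F p)) Set.univ ∧
    ∀ x : ℝ × M, (ambientMetric g).form x (xi g F x) (transversalField g F x) = 1 := by
  exact ⟨isScreenDistribution_canonicalScreen hF,
    asDistribution_canonicalScreen g F ▸ isInvolutive_dker (contMDiff_height F),
    asDistribution_canonicalScreen g F ▸ isIntegrable_dker (contMDiff_height F)
      (mfderiv_height_ne_zero hF),
    fun tr => ⟨fun htr => htr.eq_transversalLine hF,
      fun h => h ▸ isLightlikeTransversalBundle_transversalLine hF⟩,
    isTransversalFieldOn_transversalField hF, form_xi_transversalField hF⟩
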